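/- Let $G$ be a finite polygon decomposition of a connected closed oriented surface of genus $g\ge 0$, with vertex set $\mathcal G_0$, edge set $\mathcal G_1\neq\emptyset$ and face set $\mathcal G_2$, such that every edge lies between two different vertices and is shared by two different faces; the edges carry fixed orientations and the faces inherit that of the surface. ($G$ is described combinatorially by the cyclic orders of the directed edges around the faces; $g$ is given by $|\mathcal G_0|-|\mathcal G_1|+|\mathcal G_2|=2-2g$.) Let $G^*$ be the dual decomposition, the dual edge $e^*$ crossing $e$ from right to left. For $d\ge 1$ let $\mathbb Z_d=\mathbb Z/d\mathbb Z$, let $H_1(G;\mathbb Z_d)$ be the group of $1$-cycles modulo $1$-boundaries of the cellular chain complex of $G$, and let $H^1(G;\mathbb Z_d):=H_1(G^*;\mathbb Z_d)$; the $1$-cycles of $G^*$ are called cocycles. Let $b_1(G;\mathbb Z_d)$ be the smallest number of generators of $H_1(G;\mathbb Z_d)$. Let $\mathcal H_G=\bigotimes_{e\in\mathcal G_1}\mathbb C^d$, let $\omega=e^{2\pi \mathrm i/d}$, and let $X_e,Z_e$ be the unitaries that act on the factor $e$ by $Xl_i=l_{i+1}$ (indices mod $d$), $Zl_i=\omega^i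 l_i$ in the standard basis $l_0,\dots,l_{d-1}$. For a $1$-chain $\gamma=\sum_e c_e e$ and a $1$-cochain $\gamma^*=\sum_e c^*_e e^*$ over $\mathbb Z_d$ put $Z_\gamma=\prod_e Z_e^{c_e}$ and $X_{\gamma^*}=\prod_e X_e^{c^*_e}$. Let $a_v$ be the product of $X_e$ over the edges coming into $v$ and of $X_e^{-1}$ over the edges going out of $v$, let $b_f$ be the product of $Z_e^{\pm1}$ over the edges of $f$, with the sign telling whether the orientation of $e$ agrees with that of $f$, and put $A_v=\frac1d\sum_{j=0}^{d-1}a_v^j$, $B_f=\frac1d\sum_{j=0}^{d-1}b_f^j$. Let $\mathcal S_G$ be the ground state space (the eigenspace of the lowest eigenvalue) of $H_G=-\sum_{v}A_v-\sum_{f}B_f$, and let $\mathcal A(\mathcal S_G)$ be the algebra of the restrictions to $\mathcal S_G$ of the linear operators $O$ on $\mathcal H_G$ with $O\mathcal S_G\subset\mathcal S_G$. Then: (i) $\pi([\gamma])=Z_\gamma\upharpoonright\mathcal S_G$ ($\gamma$ a cycle) and $\pi^*([\gamma^*])=X_{\gamma^*}\upharpoonright\mathcal S_G$ ($\gamma^*$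 a cocycle) are well defined unitary representations of $H_1(G;\mathbb Z_d)$ and of $H^1(G;\mathbb Z_d)$ on $\mathcal S_G$. (ii) There is an isomorphism $\Phi:\mathbb Z_d^g\oplus\mathbb Z_d^g\to H_1(G;\mathbb Z_d)$. For isomorphisms $\Phi:\mathbb Z_d^g\oplus\mathbb Z_d^g\to H_1(G;\mathbb Z_d)$ and $\Phi^*:\mathbb Z_d^g\oplus\mathbb Z_d^g\to H^1(G;\mathbb Z_d)$ write $Z_{\alpha,\beta}=\pi(\Phi(\alpha,\beta))$ and $X_{\alpha,\beta}=\pi^*(\Phi^*(\alpha,\beta))$, and let $v_1,\dots,v_g$ be the standard generators of $\mathbb Z_d^g$. For all $\Phi,\Phi^*$ the algebra $\mathcal A(\mathcal S_G)$ is generated by the $4g$ operators $X_{v_i,0},X_{0,v_i},Z_{v_i,0},Z_{0,v_i}$, $1\le i\le g$, and $(X_{\alpha,\beta})^d=\mathbb I=(Z_{\alpha,\beta})^d$ for all $\alpha,\beta$. For every $\Phi$ there is exactly one $\Phi^*$ such that, with $[[A,B]]=ABA^{-1}B^{-1}$, one has $[[Z_{v_i,0},X_{0,v_i}]]=\omega\mathbb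 I=[[Z_{0,v_i},X_{v_i,0}]]$ for all $i$, while all other pairs of these generators commute. Moreover $\mathcal A(\mathcal S_G)\cong\bigotimes_{i=1}^{2g}\mathcal M_d(\mathbb C)$ as algebras. (iii) $\dim\mathcal S_G=d^{\,b_1(G;\mathbb Z_d)}=d^{2g}$. (iv) For every $\Psi\in\mathcal S_G$ with $\Psi\ne0$, $\mathcal S_G=\mathrm{span}\{X_{\tau^*}Z_\tau\Psi:\tau^*\text{ a cocycle},\ \tau\text{ a cycle}\}$. -/

import Mathlib

noncomputable section

namespace KitaevModel

/-- A dart is an edge together with a direction of travel: `(e, true)` follows the fixed orientation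
of the edge `e`, `(e, false)` runs against it. This map reverses the direction. -/
def reverse (E : Type*) : Equiv.Perm (E × Bool) :=
  (Equiv.refl E).prodCongr Equiv.boolNot

/-- A polygon decomposition, with edge set `E`, of a connected closed oriented surface, given as a
combinatorial map: the surface is glued from polygons, `faceNext x` being the dart that follows the
dart `x` on the boundary of the face to the left of `x`, and the side `x` of a polygon being glued to
the side `reverse x`. If `x` starts at the vertex `v`, then so does `faceNext (reverse x)`, and it is
the neighbour of `x` in the rotation about `v`. -/
structure PolygonDecomposition (E : Type*) where
  faceNext : Equiv.Perm (E × Bool)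
  /-- The surface is connected. -/
  connected : ∀ x y : E × Bool,
    ∃ p ∈ Subgroup.closure ({faceNext, reverse E} : Set (Equiv.Perm (E × Bool))), p x = y
  /-- Every edge lies between two different vertices. -/
  endpoints_ne : ∀ e : E, ¬ (faceNext * reverse E).SameCycle (e, true) (e, false)
  /-- Every edge is shared by two different faces. -/
  faces_ne : ∀ e : E, ¬ faceNext.SameCycle (e, true) (e, false)

namespace PolygonDecomposition

variable {E : Type*} (G : PolygonDecomposition E)

/-- Rotation about the initial vertex of a dart. -/
def vertexNext : Equiv.Perm (E × Bool) := G.faceNext * reverse E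

/-- Vertices: the cycles of the rotation (sets of darts with a common initial vertex). -/
def Vertex : Type _ := Quotient (Equiv.Perm.SameCycle.setoid G.vertexNext)

/-- Faces: the cycles of `faceNext` (sets of darts that have the face on their left). -/
def Face : Type _ := Quotient (Equiv.Perm.SameCycle.setoid G.faceNext)

def origin (x : E × Bool) : G.Vertex := Quotient.mk _ x

def leftFace (x : E × Bool) : G.Face := Quotient.mk _ x

/-- The edge `e` is oriented from `tail e` to `head e`. -/
def tail (e : E) : G.Vertex := G.origin (e, true)

def head (e : E) : G.Vertex := G.origin (e, false)

/-- The face on whose boundary `e` runs in the positive direction. -/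
def left (e : E) : G.Face := G.leftFace (e, true)

/-- The face on whose boundary `e` runs in the negative direction. -/
def right (e : E) : G.Face := G.leftFace (e, false)

instance [Finite E] : Finite G.Vertex := inferInstanceAs (Finite (Quotient _))

instance [Finite E] : Finite G.Face := inferInstanceAs (Finite (Quotient _))

instance [Finite E] : Fintype G.Vertex := Fintype.ofFinite _

instance [Finite E] : Fintype G.Face := Fintype.ofFinite _

instance : DecidableEq G.Vertex := Classical.decEq _

instance : DecidableEq G.Face := Classical.decEq _

/-- The surface has genus `g`: its Euler characteristic is `2 - 2g`. -/
def HasGenus [Fintype E] (g : ℕ) : Prop :=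
  (Fintype.card G.Vertex : ℤ) - Fintype.card E + Fintype.card G.Face = 2 - 2 * g

lemma reverse_inv : (reverse E)⁻¹ = reverse E := by
  rw [inv_eq_iff_mul_eq_one]
  ext ⟨e, b⟩ <;> simp [reverse]

/-- The dual decomposition. The dual dart of `x` crosses `x` from right to left; its initial vertex
is the face to the right of `x`, the face to its left is the initial vertex of `x`, and the darts
along that dual face are obtained by rotating `x` counterclockwise about its initial vertex. In
particular the dual edge of `e` crosses `e` from right to left. -/
def dual : PolygonDecomposition E where
  faceNext := G.vertexNext⁻¹
  connected := by
    intro x y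
    obtain ⟨p, hp, hxy⟩ := G.connected x y
    refine ⟨p, ?_, hxy⟩
    refine (Subgroup.closure_le _).2 ?_ hp
    rintro q (rfl | rfl)
    · have h1 : G.vertexNext⁻¹ ∈ Subgroup.closure
          ({G.vertexNext⁻¹, reverse E} : Set (Equiv.Perm (E × Bool))) :=
        Subgroup.subset_closure (by simp)
      have h2 : reverse E ∈ Subgroup.closure
          ({G.vertexNext⁻¹, reverse E} : Set (Equiv.Perm (E × Bool))) :=
        Subgroup.subset_closure (by simp)
      have h3 := mul_mem (inv_mem h1) (inv_mem h2)
      simpa [vertexNext] using h3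
    · exact Subgroup.subset_closure (by simp)
  endpoints_ne := by
    intro e h
    apply G.faces_ne e
    have h4 : G.vertexNext⁻¹ * reverse E = reverse E * G.faceNext⁻¹ * (reverse E)⁻¹ := by
      simp [vertexNext, mul_inv_rev, reverse_inv]
    rw [h4, Equiv.Perm.sameCycle_conj, reverse_inv, Equiv.Perm.sameCycle_inv] at h
    simpa [reverse] using h.symm
  faces_ne := by
    intro e h
    exact G.endpoints_ne e (Equiv.Perm.sameCycle_inv.1 h)

section Homology

variable [Fintype E] (d : ℕ)

/-- The boundary map on `1`-chains, `∂ e = head e - tail e`. -/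
def boundary₁ : (E → ZMod d) →ₗ[ZMod d] (G.Vertex → ZMod d) :=
  Fintype.linearCombination (ZMod d) fun e =>
    Pi.single (G.head e) (1 : ZMod d) - Pi.single (G.tail e) 1

/-- The boundary map on `2`-chains: in `∂ f` an edge of `f` has coefficient `1` or `-1` according as
its orientation agrees with that of `f` or not. -/
def boundary₂ : (G.Face → ZMod d) →ₗ[ZMod d] (E → ZMod d) :=
  Fintype.linearCombination (ZMod d) fun f e =>
    (if G.left e = f then (1 : ZMod d) else 0) - (if G.right e = f then 1 else 0)

/-- The group of `1`-cycles. -/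
def cycles : Submodule (ZMod d) (E → ZMod d) := LinearMap.ker (G.boundary₁ d)

/-- The group of `1`-boundaries. -/
def boundaries : Submodule (ZMod d) (E → ZMod d) := LinearMap.range (G.boundary₂ d)

/-- The first homology group with coefficients in `ℤ/d`. -/
abbrev H₁ : Type _ := G.cycles d ⧸ (G.boundaries d).submoduleOf (G.cycles d)

/-- The homology class of a cycle. -/
def homologyClass (γ : G.cycles d) : G.H₁ d := Submodule.Quotient.mk γ

instance [NeZero d] : AddGroup.FG (G.H₁ d) :=
  haveI : Finite (G.H₁ d) := Quotient.finite _
  AddGroup.fg_of_finite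

/-- The first Betti number: the smallest number of generators of the first homology group. -/
def betti₁ [NeZero d] : ℕ := AddGroup.rank (G.H₁ d)

end Homology

end PolygonDecomposition

/-- `ω = exp (2πi/d)`. -/
def omega (d : ℕ) : ℂ := Complex.exp (2 * Real.pi * Complex.I / d)

lemma norm_omega (d : ℕ) : ‖omega d‖ = 1 := by
  have : (2 * Real.pi * Complex.I / d : ℂ) = ((2 * Real.pi / d : ℝ) : ℂ) * Complex.I := by
    push_cast; ring
  rw [omega, this, Complex.norm_exp_ofReal_mul_I]

/-- Multiplication by a complex number of modulus one. -/
def phase (z : ℂ) (hz : ‖z‖ = 1) : ℂ ≃ₗᵢ[ℂ] ℂ where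
  toLinearEquiv := LinearEquiv.smulOfNeZero ℂ ℂ z (by rintro rfl; simp at hz)
  norm_map' x := by simp [hz]

/-- The Hilbert space `⨂_{e ∈ E} ℂ^d`, written in its product orthonormal basis
`|k⟩ = ⨂_e l_{k e}`, `k : E → ℤ/d`. -/
abbrev Hilb (E : Type*) (d : ℕ) : Type _ := EuclideanSpace ℂ (E → ZMod d)

section Operators

variable {E : Type*} [Fintype E] [DecidableEq E] {d : ℕ} [NeZero d]

/-- The operator `X` at the edge `e`: it sends the basis vector `|k⟩` to `|k + δ_e⟩`. -/
def siteX (e : E) : Hilb E d ≃ₗᵢ[ℂ] Hilb E d :=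
  LinearIsometryEquiv.piLpCongrLeft 2 ℂ ℂ (Equiv.addRight (Pi.single e (1 : ZMod d)))

/-- The operator `Z` at the edge `e`: it multiplies the basis vector `|k⟩` by `ω ^ (k e)`. -/
def siteZ (e : E) : Hilb E d ≃ₗᵢ[ℂ] Hilb E d :=
  LinearIsometryEquiv.piLpCongrRight 2 fun k =>
    phase (omega d ^ (k e).val) (by rw [norm_pow, norm_omega, one_pow])

lemma siteX_commute (e e' : E) : Commute (siteX e : Hilb E d ≃ₗᵢ[ℂ] Hilb E d) (siteX e') := by
  ext ψ k
  simp [siteX, LinearIsometryEquiv.piLpCongrLeft_apply, Equiv.piCongrLeft', sub_right_comm,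
    ← sub_eq_add_neg]

lemma siteZ_commute (e e' : E) : Commute (siteZ e : Hilb E d ≃ₗᵢ[ℂ] Hilb E d) (siteZ e') := by
  ext ψ k
  simp [siteZ, phase, mul_left_comm]

/-- `∏_e X_e ^ (n e)`. -/
def prodX (n : E → ℤ) : Hilb E d ≃ₗᵢ[ℂ] Hilb E d :=
  Finset.univ.noncommProd (fun e => siteX e ^ n e) fun e _ e' _ _ =>
    (siteX_commute e e').zpow_zpow _ _

/-- `∏_e Z_e ^ (n e)`. -/
def prodZ (n : E → ℤ) : Hilb E d ≃ₗᵢ[ℂ] Hilb E d :=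
  Finset.univ.noncommProd (fun e => siteZ e ^ n e) fun e _ e' _ _ =>
    (siteZ_commute e e').zpow_zpow _ _

/-- The string operator `X_γ = ∏_e X_e ^ (γ e)` of a `1`-cochain `γ` (a `1`-chain of the dual). -/
def stringX (γ : E → ZMod d) : Hilb E d ≃ₗᵢ[ℂ] Hilb E d := prodX fun e => ((γ e).val : ℤ)

/-- The string operator `Z_γ = ∏_e Z_e ^ (γ e)` of a `1`-chain `γ`. -/
def stringZ (γ : E → ZMod d) : Hilb E d ≃ₗᵢ[ℂ] Hilb E d := prodZ fun e => ((γ e).val : ℤ)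

/-- A unitary regarded as an element of the algebra of linear operators. -/
abbrev toEnd {K : Type*} [SeminormedAddCommGroup K] [Module ℂ K] (U : K ≃ₗᵢ[ℂ] K) :
    Module.End ℂ K := U.toLinearEquiv.toLinearMap

/-- The algebra `{O : O K ⊆ K}` of operators that leave the subspace `K` invariant. -/
def preserving {H : Type*} [AddCommGroup H] [Module ℂ H] (K : Submodule ℂ H) :
    Subalgebra ℂ (Module.End ℂ H) where
  carrier := {O | ∀ ψ ∈ K, O ψ ∈ K}
  mul_mem' ha hb ψ hψ := ha _ (hb ψ hψ)
  add_mem' ha hb ψ hψ := K.add_mem (ha ψ hψ) (hb ψ hψ)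
  algebraMap_mem' c _ hψ := K.smul_mem c hψ

/-- Restriction to `K` of the operators that leave `K` invariant. -/
def restrictHom {H : Type*} [AddCommGroup H] [Module ℂ H] (K : Submodule ℂ H) :
    preserving K →ₐ[ℂ] Module.End ℂ K where
  toFun O := O.1.restrict O.2
  map_one' := rfl
  map_mul' _ _ := rfl
  map_zero' := rfl
  map_add' _ _ := rfl
  commutes' _ := rfl

/-- The algebra `A(K)` of the operators `O` with `O K ⊆ K`, acting on `K`. -/
def algebraOn {H : Type*} [AddCommGroup H] [Module ℂ H] (K : Submodule ℂ H) :
    Subalgebra ℂ (Module.End ℂ K) := (restrictHom K).range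

namespace PolygonDecomposition

variable (G : PolygonDecomposition E)

/-- `a_v`: the product of `X_e` over the edges coming into `v` and of `X_e⁻¹` over the edges going
out of `v`. -/
def vertexUnitary (v : G.Vertex) : Hilb E d ≃ₗᵢ[ℂ] Hilb E d :=
  prodX fun e => (if G.head e = v then 1 else 0) - (if G.tail e = v then 1 else 0)

/-- `b_f`: the product of `Z_e` over the positively oriented edges of `f` and of `Z_e⁻¹` over the
negatively oriented ones. -/
def faceUnitary (f : G.Face) : Hilb E d ≃ₗᵢ[ℂ] Hilb E d :=
  prodZ fun e => (if G.left e = f then 1 else 0) - (if G.right e = f then 1 else 0)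

/-- `A_v = d⁻¹ ∑_{j < d} (a_v)^j`. -/
def vertexOperator (v : G.Vertex) : Module.End ℂ (Hilb E d) :=
  (d : ℂ)⁻¹ • ∑ j ∈ Finset.range d, toEnd (G.vertexUnitary v) ^ j

/-- `B_f = d⁻¹ ∑_{j < d} (b_f)^j`. -/
def faceOperator (f : G.Face) : Module.End ℂ (Hilb E d) :=
  (d : ℂ)⁻¹ • ∑ j ∈ Finset.range d, toEnd (G.faceUnitary f) ^ j

variable (d)

/-- The Hamiltonian `-∑_v A_v - ∑_f B_f`. -/
def hamiltonian : Module.End ℂ (Hilb E d) :=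
  -(∑ v, G.vertexOperator v) - ∑ f, G.faceOperator f

/-- The lowest eigenvalue of the Hamiltonian. -/
def groundEnergy : ℝ := sInf {x : ℝ | (G.hamiltonian d).HasEigenvalue (x : ℂ)}

/-- The ground state space: the eigenspace of the lowest eigenvalue. -/
def groundSpace : Submodule ℂ (Hilb E d) :=
  (G.hamiltonian d).eigenspace (G.groundEnergy d : ℂ)

end PolygonDecomposition

end Operators

/-- Labels `(α, β)` of (co)homology classes. -/
abbrev Label (g d : ℕ) : Type := (Fin g → ZMod d) × (Fin g → ZMod d)

/-- The label `(v_i, 0)`. -/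
def lab₁ {g d : ℕ} (i : Fin g) : Label g d := (Pi.single i 1, 0)

/-- The label `(0, v_i)`. -/
def lab₂ {g d : ℕ} (i : Fin g) : Label g d := (0, Pi.single i 1)

/-- The multiplicative commutator. -/
def gcomm {U : Type*} [Group U] (A B : U) : U := A * B * A⁻¹ * B⁻¹

/-- The Weyl commutation relations: the commutators of
`Z_{v_i,0}`, `X_{0,v_i}` and of `Z_{0,v_i}`, `X_{v_i,0}` are `ω`, and all others are trivial. -/
structure WeylRelations {g d : ℕ} {K : Type*} [SeminormedAddCommGroup K] [Module ℂ K]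
    (Z X : Label g d → (K ≃ₗᵢ[ℂ] K)) : Prop where
  comm₁₂ : ∀ i, toEnd (gcomm (Z (lab₁ i)) (X (lab₂ i))) = omega d • (1 : Module.End ℂ K)
  comm₂₁ : ∀ i, toEnd (gcomm (Z (lab₂ i)) (X (lab₁ i))) = omega d • (1 : Module.End ℂ K)
  comm₁₂_ne : ∀ i j, i ≠ j → gcomm (Z (lab₁ i)) (X (lab₂ j)) = 1
  comm₂₁_ne : ∀ i j, i ≠ j → gcomm (Z (lab₂ i)) (X (lab₁ j)) = 1
  comm₁₁ : ∀ i j, gcomm (Z (lab₁ i)) (X (lab₁ j)) = 1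
  comm₂₂ : ∀ i j, gcomm (Z (lab₂ i)) (X (lab₂ j)) = 1
  commZ : ∀ i j, gcomm (Z (lab₁ i)) (Z (lab₁ j)) = 1 ∧ gcomm (Z (lab₁ i)) (Z (lab₂ j)) = 1 ∧
    gcomm (Z (lab₂ i)) (Z (lab₂ j)) = 1
  commX : ∀ i j, gcomm (X (lab₁ i)) (X (lab₁ j)) = 1 ∧ gcomm (X (lab₁ i)) (X (lab₂ j)) = 1 ∧
    gcomm (X (lab₂ i)) (X (lab₂ j)) = 1

end KitaevModel

end

open KitaevModel
open scoped TensorProduct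

/-!
The computational basis of `Hilb E d` consists of the cochains `k`. In it `X` of a cochain is a
translation and `Z` of a chain `γ` is multiplication by the character `k ↦ exp (2πi γ·k / d)`.
Averages of powers of unitaries are contractions, so `-∑ A_v - ∑ B_f` attains its lowest conceivable
eigenvalue exactly on the vectors fixed by all `a_v` and `b_f`, provided there are such vectors: the
wave functions that are supported on the cocycles and invariant under translation by coboundaries,
that is, the functions on the first cohomology. Over `ℤ` the chain complex of a connected surface
contracts onto the free module `ℤ^(2g)` in degree `1` (the rank comes from the trace of an
idempotent), hence so does the complex over every `ℤ/d`. The contraction identifies homology and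
cohomology with `(ℤ/d)^(2g)` in such a way that the intersection pairing becomes the dot product,
and the ground space with the Hilbert space of `2g` qudits on which homology acts by the operators
`Z` and cohomology by the operators `X`. By character orthogonality the products of these operators
span all matrices, which gives the generators and the cyclicity of every nonzero vector; the
commutation relations ask for the labelling that is dual to the given one under a perfect pairing.
-/

namespace KitaevModel

open Matrix

/-! ### Contractions of complexes -/

section HomologySplitting

variable {R ι V F κ : Type*} [CommRing R] [Fintype ι] [Fintype V] [Fintype F] [Fintype κ]
  [DecidableEq ι] [DecidableEq κ]

/-- A contraction of the complex `R^F → R^ι → R^V` with differentials `D₂` and `D₁` onto a free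
module `R^κ` placed in the middle degree: `proj` and `incl` are mutually inverse up to the chain
homotopy `(homotopy₀, homotopy₁)`. It provides coordinates on the homology of the complex and, after
transposition, dual coordinates on its cohomology. -/
structure HomologySplitting (D₁ : Matrix V ι R) (D₂ : Matrix ι F R) (κ : Type*) [Fintype κ]
    [DecidableEq κ] where
  proj : Matrix κ ι R
  incl : Matrix ι κ R
  homotopy₀ : Matrix ι V R
  homotopy₁ : Matrix F ι R
  proj_mul_incl : proj * incl = 1
  incl_mul_proj_add : incl * proj + homotopy₀ * D₁ + D₂ * homotopy₁ = 1
  proj_mul : proj * D₂ = 0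
  mul_incl : D₁ * incl = 0
  mul_eq_zero : D₁ * D₂ = 0

namespace HomologySplitting

variable {D₁ : Matrix V ι R} {D₂ : Matrix ι F R} (σ : HomologySplitting D₁ D₂ κ)

/-- Base change of a splitting along a ring homomorphism. -/
def map {S : Type*} [CommRing S] (f : R →+* S) : HomologySplitting (D₁.map f) (D₂.map f) κ where
  proj := σ.proj.map f
  incl := σ.incl.map f
  homotopy₀ := σ.homotopy₀.map f
  homotopy₁ := σ.homotopy₁.map f
  proj_mul_incl := by rw [← Matrix.map_mul, σ.proj_mul_incl, Matrix.map_one _ f.map_zero f.map_one]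
  incl_mul_proj_add := by
    rw [← Matrix.map_one f f.map_zero f.map_one, ← σ.incl_mul_proj_add,
      Matrix.map_add _ f.map_add, Matrix.map_add _ f.map_add, Matrix.map_mul, Matrix.map_mul,
      Matrix.map_mul]
  proj_mul := by rw [← Matrix.map_mul, σ.proj_mul, Matrix.map_zero _ f.map_zero]
  mul_incl := by rw [← Matrix.map_mul, σ.mul_incl, Matrix.map_zero _ f.map_zero]
  mul_eq_zero := by rw [← Matrix.map_mul, σ.mul_eq_zero, Matrix.map_zero _ f.map_zero]

/-- The splitting of the dual complex. -/
def transpose : HomologySplitting D₂ᵀ D₁ᵀ κ where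
  proj := σ.inclᵀ
  incl := σ.projᵀ
  homotopy₀ := σ.homotopy₁ᵀ
  homotopy₁ := σ.homotopy₀ᵀ
  proj_mul_incl := by rw [← transpose_mul, σ.proj_mul_incl, transpose_one]
  incl_mul_proj_add := by
    rw [← transpose_one, ← σ.incl_mul_proj_add, transpose_add, transpose_add, transpose_mul,
      transpose_mul, transpose_mul, add_right_comm]
  proj_mul := by rw [← transpose_mul, σ.mul_incl, transpose_zero]
  mul_incl := by rw [← transpose_mul, σ.proj_mul, transpose_zero]
  mul_eq_zero := by rw [← transpose_mul, σ.mul_eq_zero, transpose_zero]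

lemma proj_mulVec_incl_mulVec (w : κ → R) : σ.proj *ᵥ (σ.incl *ᵥ w) = w := by
  rw [mulVec_mulVec, σ.proj_mul_incl, one_mulVec]

lemma proj_mulVec_mulVec (c : F → R) : σ.proj *ᵥ (D₂ *ᵥ c) = 0 := by
  rw [mulVec_mulVec, σ.proj_mul, zero_mulVec]

lemma mulVec_incl_mulVec (w : κ → R) : D₁ *ᵥ (σ.incl *ᵥ w) = 0 := by
  rw [mulVec_mulVec, σ.mul_incl, zero_mulVec]

lemma eq_incl_add_of_mulVec_eq_zero {γ : ι → R} (hγ : D₁ *ᵥ γ = 0) :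
    γ = σ.incl *ᵥ (σ.proj *ᵥ γ) + D₂ *ᵥ (σ.homotopy₁ *ᵥ γ) := by
  have h := congrArg (· *ᵥ γ) σ.incl_mul_proj_add
  simpa only [add_mulVec, ← mulVec_mulVec, hγ, mulVec_zero, add_zero, one_mulVec] using h.symm

lemma proj_mulVec_eq_zero_iff {γ : ι → R} (hγ : D₁ *ᵥ γ = 0) :
    σ.proj *ᵥ γ = 0 ↔ ∃ c, D₂ *ᵥ c = γ := by
  constructor
  · intro h
    refine ⟨σ.homotopy₁ *ᵥ γ, ?_⟩
    have hsplit := σ.eq_incl_add_of_mulVec_eq_zero hγ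
    rwa [h, mulVec_zero, zero_add, eq_comm] at hsplit
  · rintro ⟨c, rfl⟩
    exact σ.proj_mulVec_mulVec c

/-- The coordinates on the homology of a complex that are given by a splitting. -/
noncomputable def homologyEquiv :
    (LinearMap.ker D₁.mulVecLin ⧸
      (LinearMap.range D₂.mulVecLin).submoduleOf (LinearMap.ker D₁.mulVecLin)) ≃ₗ[R] (κ → R) :=
  let p := σ.proj.mulVecLin ∘ₗ (LinearMap.ker D₁.mulVecLin).subtype
  have hker : (LinearMap.range D₂.mulVecLin).submoduleOf (LinearMap.ker D₁.mulVecLin) =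
      LinearMap.ker p := by
    ext γ
    exact (σ.proj_mulVec_eq_zero_iff γ.2).symm
  have hsurj : Function.Surjective p := fun w =>
    ⟨⟨σ.incl *ᵥ w, σ.mulVec_incl_mulVec w⟩, σ.proj_mulVec_incl_mulVec w⟩
  (Submodule.quotEquivOfEq _ _ hker).trans (p.quotKerEquivOfSurjective hsurj)

lemma homologyEquiv_mk (γ : LinearMap.ker D₁.mulVecLin) :
    σ.homologyEquiv (Submodule.Quotient.mk γ) = σ.proj *ᵥ γ := rfl

end HomologySplitting

end HomologySplitting

section Existence

variable {R ι V F : Type*} [CommRing R] [Fintype ι]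

theorem exists_mul_eq_of_isIdempotentElem [IsDomain R] [IsPrincipalIdealRing R] [CharZero R]
    {P : Matrix ι ι R} (hP : IsIdempotentElem P) {n : ℕ} (htr : P.trace = n) :
    ∃ (A : Matrix (Fin n) ι R) (B : Matrix ι (Fin n) R), B * A = P ∧ A * B = 1 := by
  classical
  set f : (ι → R) →ₗ[R] (ι → R) := toLin' P with hf
  have hproj : LinearMap.IsProj (LinearMap.range f) f := by
    refine ⟨fun x => ⟨x, rfl⟩, ?_⟩
    rintro _ ⟨x, rfl⟩
    rw [hf, ← LinearMap.comp_apply, ← toLin'_mul, hP.eq]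
  have hrank : Module.finrank R (LinearMap.range f) = n := by
    have h := hproj.trace
    rw [hf, trace_toLin'_eq, htr] at h
    exact_mod_cast h.symm
  let b := Module.finBasisOfFinrankEq R (LinearMap.range f) hrank
  let p : (ι → R) →ₗ[R] (Fin n → R) := b.equivFun.toLinearMap ∘ₗ f.rangeRestrict
  let i : (Fin n → R) →ₗ[R] (ι → R) := (LinearMap.range f).subtype ∘ₗ b.equivFun.symm.toLinearMap
  have hip : i ∘ₗ p = f := LinearMap.ext fun x => by simp [i, p]
  have hpi : p ∘ₗ i = LinearMap.id := LinearMap.ext fun x => by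
    have h : f.rangeRestrict (i x) = b.equivFun.symm x :=
      Subtype.ext (hproj.map_id _ (b.equivFun.symm x).2)
    rw [LinearMap.comp_apply, LinearMap.comp_apply, h]
    exact b.equivFun.apply_symm_apply x
  refine ⟨LinearMap.toMatrix' p, LinearMap.toMatrix' i, ?_, ?_⟩
  · rw [← LinearMap.toMatrix'_comp, hip, hf, LinearMap.toMatrix'_toLin']
  · rw [← LinearMap.toMatrix'_comp, hpi, LinearMap.toMatrix'_id]

lemma isIdempotentElem_mul_of_mul_mul_eq [Fintype V] {D : Matrix V ι R} {s : Matrix ι V R}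
    (hs : D * s * D = D) : IsIdempotentElem (s * D) := by
  rw [IsIdempotentElem, Matrix.mul_assoc, ← Matrix.mul_assoc D, hs]

variable [DecidableEq ι] [Fintype V] [Fintype F] {D₁ : Matrix V ι R} {D₂ : Matrix ι F R}
  {s : Matrix ι V R} {t : Matrix F ι R}

lemma mul_one_sub_mul_one_sub (h : D₁ * D₂ = 0) (hs : D₁ * s * D₁ = D₁) :
    D₁ * ((1 - D₂ * t) * (1 - s * D₁)) = 0 := by
  rw [← Matrix.mul_assoc, Matrix.mul_sub D₁, Matrix.mul_one, ← Matrix.mul_assoc, h,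
    Matrix.zero_mul, sub_zero, Matrix.mul_sub, Matrix.mul_one, ← Matrix.mul_assoc, hs, sub_self]

lemma one_sub_mul_one_sub_mul (h : D₁ * D₂ = 0) (ht : D₂ * t * D₂ = D₂) :
    (1 - D₂ * t) * (1 - s * D₁) * D₂ = 0 := by
  rw [Matrix.mul_assoc, Matrix.sub_mul 1 (s * D₁), Matrix.one_mul, Matrix.mul_assoc s, h,
    Matrix.mul_zero, sub_zero, Matrix.sub_mul, Matrix.one_mul, ht, sub_self]

lemma isIdempotentElem_one_sub_mul_one_sub (h : D₁ * D₂ = 0) (hs : D₁ * s * D₁ = D₁)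
    (ht : D₂ * t * D₂ = D₂) : IsIdempotentElem ((1 - D₂ * t) * (1 - s * D₁)) := by
  have hQ : (1 - s * D₁) * (1 - s * D₁) = 1 - s * D₁ :=
    (isIdempotentElem_mul_of_mul_mul_eq hs).one_sub
  have hP := one_sub_mul_one_sub_mul (s := s) h ht
  calc (1 - D₂ * t) * (1 - s * D₁) * ((1 - D₂ * t) * (1 - s * D₁))
      = ((1 - D₂ * t) * (1 - s * D₁) - (1 - D₂ * t) * (1 - s * D₁) * D₂ * t) * (1 - s * D₁) := by
        simp only [← Matrix.mul_assoc, Matrix.mul_sub, Matrix.mul_one]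
    _ = (1 - D₂ * t) * (1 - s * D₁) := by
        rw [hP, Matrix.zero_mul, sub_zero, Matrix.mul_assoc, hQ]

lemma trace_one_sub_mul_one_sub (h : D₁ * D₂ = 0) :
    ((1 - D₂ * t) * (1 - s * D₁)).trace =
      Fintype.card ι - (D₁ * s).trace - (t * D₂).trace := by
  have hcross : (D₂ * t * (s * D₁)).trace = 0 := by
    rw [← Matrix.mul_assoc, trace_mul_comm, ← Matrix.mul_assoc, ← Matrix.mul_assoc, h]
    simp only [Matrix.zero_mul, trace_zero]
  rw [Matrix.sub_mul, Matrix.one_mul, Matrix.mul_sub, Matrix.mul_one, trace_sub, trace_sub,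
    trace_sub, hcross, trace_one, trace_mul_comm s, trace_mul_comm D₂]
  ring

/-- The idempotent `(1 - D₂ t) (1 - s D₁)` projects onto a complement of the boundaries in the
cycles. -/
theorem nonempty_homologySplitting [IsDomain R] [IsPrincipalIdealRing R] [CharZero R]
    (h : D₁ * D₂ = 0) (hs : D₁ * s * D₁ = D₁) (ht : D₂ * t * D₂ = D₂) {n : ℕ}
    (hn : (D₁ * s).trace + (t * D₂).trace + n = Fintype.card ι) :
    Nonempty (HomologySplitting D₁ D₂ (Fin n)) := by
  have htr : ((1 - D₂ * t) * (1 - s * D₁)).trace = (n : R) := by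
    rw [trace_one_sub_mul_one_sub h, ← hn]
    ring
  obtain ⟨A, B, hBA, hAB⟩ :=
    exists_mul_eq_of_isIdempotentElem (isIdempotentElem_one_sub_mul_one_sub h hs ht) htr
  refine ⟨⟨A, B, s, t * (1 - s * D₁), hAB, ?_, ?_, ?_, h⟩⟩
  · rw [hBA, Matrix.sub_mul, Matrix.one_mul, ← Matrix.mul_assoc]
    abel
  · have hA : A = A * (B * A) := by rw [← Matrix.mul_assoc, hAB, Matrix.one_mul]
    rw [hA, hBA, Matrix.mul_assoc, one_sub_mul_one_sub_mul h ht, Matrix.mul_zero]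
  · have hB : B = B * A * B := by rw [Matrix.mul_assoc, hAB, Matrix.mul_one]
    rw [hB, hBA, ← Matrix.mul_assoc, mul_one_sub_mul_one_sub h hs, Matrix.zero_mul]

end Existence

/-! ### The chain complex of a polygon decomposition -/

section Incidence

variable {E Q : Type*} [DecidableEq Q] (R : Type*) [Ring R]

/-- The signed incidence matrix of a labelling `o` of the darts: the column of the edge `e` is
`o (e, false) - o (e, true)`. -/
def incidence (o : E × Bool → Q) : Matrix Q E R :=
  Matrix.of fun q e => (if o (e, false) = q then 1 else 0) - (if o (e, true) = q then 1 else 0)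

lemma incidence_apply (o : E × Bool → Q) (q : Q) (e : E) :
    incidence R o q e = (if o (e, false) = q then 1 else 0) - (if o (e, true) = q then 1 else 0) :=
  rfl

lemma incidence_map {S : Type*} [Ring S] (f : R →+* S) (o : E × Bool → Q) :
    (incidence R o).map f = incidence S o := by
  ext q e
  simp only [map_apply, incidence_apply, map_sub, apply_ite f, map_one, map_zero]

lemma incidence_mulVec_single [Fintype E] [DecidableEq E] (o : E × Bool → Q) (e : E) :
    incidence R o *ᵥ Pi.single e 1 = Pi.single (o (e, false)) 1 - Pi.single (o (e, true)) 1 := by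
  ext q
  simp [incidence_apply, Pi.single_apply, eq_comm]

end Incidence

namespace PolygonDecomposition

variable {E : Type*} (G : PolygonDecomposition E)

lemma origin_faceNext (x : E × Bool) : G.origin (G.faceNext x) = G.origin (reverse E x) := by
  refine (Quotient.sound (s := Equiv.Perm.SameCycle.setoid G.vertexNext) ⟨1, ?_⟩ :).symm
  obtain ⟨e, b⟩ := x
  simp [vertexNext, reverse]

lemma leftFace_faceNext (x : E × Bool) : G.leftFace (G.faceNext x) = G.leftFace x :=
  Quotient.sound (s := Equiv.Perm.SameCycle.setoid G.faceNext)
    ((Equiv.Perm.SameCycle.refl _ x).apply_left)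

section Connected

variable {Q R : Type*} [DecidableEq Q] [Ring R] [Fintype E] {o : E × Bool → Q}

/-- The hypothesis `ho` holds for the vertices as well as for the faces. -/
lemma exists_incidence_mulVec_eq
    (ho : ∀ x, o (G.faceNext x) = o x ∨ o (G.faceNext x) = o (reverse E x)) (x y : E × Bool) :
    ∃ c : E → R, incidence R o *ᵥ c = Pi.single (o y) 1 - Pi.single (o x) 1 := by
  classical
  have hrev (x : E × Bool) :
      ∃ c : E → R, incidence R o *ᵥ c = Pi.single (o (reverse E x)) 1 - Pi.single (o x) 1 := by
    obtain ⟨e, _ | _⟩ := x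
    · exact ⟨-Pi.single e 1, by rw [mulVec_neg, incidence_mulVec_single]; simp [reverse]⟩
    · exact ⟨Pi.single e 1, by rw [incidence_mulVec_single]; simp [reverse]⟩
  obtain ⟨p, hp, rfl⟩ := G.connected x y
  induction hp using Subgroup.closure_induction generalizing x with
  | mem p hp =>
    rcases hp with rfl | rfl
    · rcases ho x with h | h
      · exact ⟨0, by simp [h]⟩
      · rw [h]; exact hrev x
    · exact hrev x
  | one => exact ⟨0, by simp⟩
  | mul p q _ _ ihp ihq =>
    obtain ⟨c, hc⟩ := ihp (q x)
    obtain ⟨c', hc'⟩ := ihq x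
    exact ⟨c + c', by rw [mulVec_add, hc, hc', Equiv.Perm.mul_apply]; abel⟩
  | inv p _ ih =>
    obtain ⟨c, hc⟩ := ih (p⁻¹ x)
    exact ⟨-c, by rw [mulVec_neg, hc]; simp⟩

lemma exists_incidence_mul_mul_eq [Fintype Q] [Nonempty E] (hs : Function.Surjective o)
    (ho : ∀ x, o (G.faceNext x) = o x ∨ o (G.faceNext x) = o (reverse E x)) :
    ∃ s : Matrix E Q R, incidence R o * s * incidence R o = incidence R o ∧
      (incidence R o * s).trace = Fintype.card Q - 1 := by
  obtain ⟨e₀⟩ := ‹Nonempty E›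
  set q₀ := o (e₀, true)
  have h (q : Q) : ∃ c : E → R, incidence R o *ᵥ c = Pi.single q 1 - Pi.single q₀ 1 := by
    obtain ⟨y, rfl⟩ := hs q
    exact G.exists_incidence_mulVec_eq ho _ y
  choose c hc using h
  have hsec : incidence R o * (of c)ᵀ = 1 - of fun q _ => (Pi.single q₀ 1 : Q → R) q := by
    ext q r
    have hqr := congrFun (hc r) q
    simp only [mulVec, dotProduct, Pi.sub_apply] at hqr
    simp only [mul_apply, transpose_apply, of_apply, Matrix.sub_apply, hqr]
    simp [one_apply, Pi.single_apply]
  refine ⟨(of c)ᵀ, ?_, ?_⟩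
  · rw [hsec, Matrix.sub_mul, Matrix.one_mul, sub_eq_self]
    ext q e
    simp [mul_apply, ← Finset.mul_sum, incidence_apply]
  · rw [hsec, trace_sub, trace_one]
    simp [trace, Pi.single_apply]

end Connected

section BoundaryMatrix

variable (R : Type*) [CommRing R]

/-- The matrix of the boundary map on `1`-chains with coefficients in `R`. -/
noncomputable def boundaryMatrix₁ : Matrix G.Vertex E R := incidence R G.origin

/-- The matrix of the boundary map on `2`-chains with coefficients in `R`. -/
noncomputable def boundaryMatrix₂ : Matrix E G.Face R := -(incidence R G.leftFace)ᵀ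

variable {R}

lemma boundaryMatrix₁_apply (v : G.Vertex) (e : E) :
    G.boundaryMatrix₁ R v e = (if G.head e = v then 1 else 0) - (if G.tail e = v then 1 else 0) :=
  rfl

lemma boundaryMatrix₂_apply (e : E) (f : G.Face) :
    G.boundaryMatrix₂ R e f = (if G.left e = f then 1 else 0) - (if G.right e = f then 1 else 0) :=
  neg_sub _ _

lemma boundaryMatrix₁_map {S : Type*} [CommRing S] (f : R →+* S) :
    (G.boundaryMatrix₁ R).map f = G.boundaryMatrix₁ S :=
  incidence_map R f G.origin

lemma boundaryMatrix₂_map {S : Type*} [CommRing S] (f : R →+* S) :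
    (G.boundaryMatrix₂ R).map f = G.boundaryMatrix₂ S := by
  rw [boundaryMatrix₂, boundaryMatrix₂, ← incidence_map R f]
  ext e q
  exact map_neg f _

variable [Fintype E]

/-- Along the boundary of a face, the head of every dart is the tail of the next one, so the sum
telescopes. -/
lemma boundaryMatrix₁_mul_boundaryMatrix₂ : G.boundaryMatrix₁ R * G.boundaryMatrix₂ R = 0 := by
  rw [boundaryMatrix₁, boundaryMatrix₂, Matrix.mul_neg, neg_eq_zero]
  ext v f
  have hdarts : (incidence R G.origin * (incidence R G.leftFace)ᵀ) v f =
      ∑ x : E × Bool, ((if G.leftFace x = f then 1 else 0) * (if G.origin x = v then 1 else 0) -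
        (if G.leftFace x = f then 1 else 0) * (if G.origin (G.faceNext x) = v then 1 else 0)) := by
    rw [mul_apply, Fintype.sum_prod_type]
    refine Finset.sum_congr rfl fun e _ => ?_
    simp only [Fintype.sum_bool, origin_faceNext, transpose_apply, incidence_apply, reverse,
      Equiv.prodCongr_apply, Prod.map_apply, Equiv.boolNot_apply, Bool.not_true, Bool.not_false,
      Equiv.refl_apply]
    ring
  rw [hdarts, Finset.sum_sub_distrib, ← Equiv.sum_comp G.faceNext]
  simp only [leftFace_faceNext, sub_self, Matrix.zero_apply]

variable [DecidableEq E] [Nonempty E] {g : ℕ}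

lemma nonempty_homologySplitting_int (hg : G.HasGenus g) :
    Nonempty (HomologySplitting (G.boundaryMatrix₁ ℤ) (G.boundaryMatrix₂ ℤ) (Fin (2 * g))) := by
  obtain ⟨s, hs, hs_trace⟩ := G.exists_incidence_mul_mul_eq (R := ℤ) (o := G.origin)
    Quotient.mk_surjective fun x => .inr (G.origin_faceNext x)
  obtain ⟨t, ht, ht_trace⟩ := G.exists_incidence_mul_mul_eq (R := ℤ) (o := G.leftFace)
    Quotient.mk_surjective fun x => .inl (G.leftFace_faceNext x)
  refine nonempty_homologySplitting G.boundaryMatrix₁_mul_boundaryMatrix₂ (s := s) (t := -tᵀ)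
    hs ?_ ?_
  · simp only [boundaryMatrix₂, Matrix.neg_mul, Matrix.mul_neg, neg_neg, ← transpose_mul,
      ← Matrix.mul_assoc, ht]
  · rw [boundaryMatrix₁, boundaryMatrix₂, Matrix.neg_mul, Matrix.mul_neg, neg_neg, ← transpose_mul,
      trace_transpose, hs_trace, ht_trace]
    unfold HasGenus at hg
    push_cast
    linarith

theorem nonempty_homologySplitting (hg : G.HasGenus g) (R : Type*) [CommRing R] :
    Nonempty (HomologySplitting (G.boundaryMatrix₁ R) (G.boundaryMatrix₂ R) (Fin (2 * g))) := by
  obtain ⟨σ⟩ := G.nonempty_homologySplitting_int hg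
  rw [← G.boundaryMatrix₁_map (Int.castRingHom R), ← G.boundaryMatrix₂_map (Int.castRingHom R)]
  exact ⟨σ.map _⟩

end BoundaryMatrix

section Homology

variable [Fintype E] {d : ℕ}

lemma cycles_eq_ker : G.cycles d = LinearMap.ker (G.boundaryMatrix₁ (ZMod d)).mulVecLin := by
  rw [cycles]
  congr 1
  refine LinearMap.ext fun γ => funext fun v => ?_
  simp only [boundary₁, Fintype.linearCombination_apply, Finset.sum_apply, mulVecLin_apply, mulVec,
    dotProduct, boundaryMatrix₁_apply, Pi.smul_apply, Pi.sub_apply, smul_eq_mul, Pi.single_apply,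
    eq_comm, mul_comm]

lemma boundaries_eq_range :
    G.boundaries d = LinearMap.range (G.boundaryMatrix₂ (ZMod d)).mulVecLin := by
  rw [boundaries]
  congr 1
  refine LinearMap.ext fun c => funext fun e => ?_
  simp only [boundary₂, Fintype.linearCombination_apply, Finset.sum_apply, mulVecLin_apply, mulVec,
    dotProduct, boundaryMatrix₂_apply, Pi.smul_apply, smul_eq_mul, mul_comm]

end Homology

section Dual

/-- The vertices of the dual decomposition as faces: a dual dart starts in the face to the right of
the dart with the same name. -/
def dualVertexEquiv : G.dual.Vertex ≃ G.Face :=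
  Quotient.congr (reverse E) fun x y => by
    change (G.vertexNext⁻¹ * reverse E).SameCycle x y ↔ G.faceNext.SameCycle _ _
    have h : G.vertexNext⁻¹ * reverse E = reverse E * G.faceNext⁻¹ * (reverse E)⁻¹ := by
      simp only [vertexNext, _root_.mul_inv_rev, reverse_inv]
    rw [h, Equiv.Perm.sameCycle_conj, reverse_inv, Equiv.Perm.sameCycle_inv]

/-- The faces of the dual decomposition as vertices. -/
def dualFaceEquiv : G.dual.Face ≃ G.Vertex :=
  Quotient.congr (Equiv.refl _) fun _ _ => Equiv.Perm.sameCycle_inv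

lemma dualVertexEquiv_origin (x : E × Bool) :
    G.dualVertexEquiv (G.dual.origin x) = G.leftFace (reverse E x) := rfl

lemma dualFaceEquiv_leftFace (x : E × Bool) :
    G.dualFaceEquiv (G.dual.leftFace x) = G.origin x := rfl

lemma boundaryMatrix₁_dual (R : Type*) [CommRing R] :
    G.dual.boundaryMatrix₁ R =
      reindex G.dualVertexEquiv.symm (Equiv.refl E) (G.boundaryMatrix₂ R)ᵀ := by
  ext f e
  simp only [boundaryMatrix₁_apply, reindex_apply, submatrix_apply, transpose_apply,
    boundaryMatrix₂_apply, ← G.dualVertexEquiv.apply_eq_iff_eq, head, tail, dualVertexEquiv_origin]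
  rfl

lemma boundaryMatrix₂_dual (R : Type*) [CommRing R] :
    G.dual.boundaryMatrix₂ R =
      reindex (Equiv.refl E) G.dualFaceEquiv.symm (-(G.boundaryMatrix₁ R)ᵀ) := by
  ext e v
  simp only [boundaryMatrix₂_apply, reindex_apply, submatrix_apply, Matrix.neg_apply,
    transpose_apply, boundaryMatrix₁_apply, ← G.dualFaceEquiv.apply_eq_iff_eq, left, right,
    dualFaceEquiv_leftFace, neg_sub]
  rfl

variable [Fintype E] {d : ℕ}

lemma dual_cycles_eq_ker :
    G.dual.cycles d = LinearMap.ker (G.boundaryMatrix₂ (ZMod d))ᵀ.mulVecLin := by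
  rw [cycles_eq_ker, boundaryMatrix₁_dual, mulVecLin_reindex, LinearEquiv.ker_comp]
  rfl

lemma dual_boundaries_eq_range :
    G.dual.boundaries d = LinearMap.range (G.boundaryMatrix₁ (ZMod d))ᵀ.mulVecLin := by
  have hneg : (-(G.boundaryMatrix₁ (ZMod d))ᵀ).mulVecLin =
      -(G.boundaryMatrix₁ (ZMod d))ᵀ.mulVecLin := LinearMap.ext fun c => neg_mulVec c _
  rw [boundaries_eq_range, boundaryMatrix₂_dual, mulVecLin_reindex, ← LinearMap.comp_assoc,
    LinearEquiv.range_comp, hneg, ← LinearMap.range_neg (G.boundaryMatrix₁ (ZMod d))ᵀ.mulVecLin]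
  rfl

end Dual

end PolygonDecomposition

/-! ### String operators -/

section StringOperators

lemma map_ofAdd_pow_card {d : ℕ} {M U : Type*} [AddCommGroup M] [Module (ZMod d) M] [Group U]
    (ρ : Multiplicative M →* U) (a : M) : ρ (.ofAdd a) ^ d = 1 := by
  rw [← map_pow, ← ofAdd_nsmul, ← Nat.cast_smul_eq_nsmul (ZMod d), ZMod.natCast_self, zero_smul,
    ofAdd_zero, map_one]

variable {E : Type*} [Fintype E] [DecidableEq E] {d : ℕ}

lemma noncommProd_map_single_zpow {U : Type*} [Group U] (ρ : Multiplicative (E → ZMod d) →* U)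
    (n : E → ℤ)
    (hcomm : (↑(Finset.univ : Finset E) : Set E).Pairwise
      (Function.onFun Commute fun e => ρ (.ofAdd (Pi.single e 1)) ^ n e)) :
    Finset.univ.noncommProd (fun e => ρ (.ofAdd (Pi.single e 1)) ^ n e) hcomm =
      ρ (.ofAdd fun e => (n e : ZMod d)) := by
  have hprod : ∏ e, (Multiplicative.ofAdd (Pi.single e (1 : ZMod d) : E → ZMod d)) ^ n e =
      .ofAdd fun e => (n e : ZMod d) := by
    apply Multiplicative.toAdd.injective
    ext e
    simp [toAdd_prod, Finset.sum_apply, Pi.single_apply]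
  rw [← hprod, ← Finset.noncommProd_eq_prod]
  refine Eq.trans ?_ (Finset.map_noncommProd Finset.univ _ _ ρ).symm
  exact Finset.noncommProd_congr rfl (fun e _ => (map_zpow ρ _ _).symm) _

variable [NeZero d]

lemma omega_pow_val (j : ZMod d) : omega d ^ j.val = ZMod.stdAddChar j := by
  rw [ZMod.stdAddChar_apply, ZMod.toCircle_apply, omega, ← Complex.exp_nat_mul]
  ring_nf

lemma omega_eq_stdAddChar : omega d = ZMod.stdAddChar (1 : ZMod d) := by
  have h := ZMod.stdAddChar_coe (N := d) 1
  rw [Int.cast_one] at h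
  rw [h, omega, Int.cast_one, mul_one]

/-- The regular representation of the cochains, by translations of the computational basis. -/
noncomputable def shiftRep : Multiplicative (E → ZMod d) →* (Hilb E d ≃ₗᵢ[ℂ] Hilb E d) where
  toFun γ := LinearIsometryEquiv.piLpCongrLeft 2 ℂ ℂ (Equiv.addRight γ.toAdd)
  map_one' := by
    ext ψ k
    change ψ (k + -0) = ψ k
    rw [neg_zero, add_zero]
  map_mul' γ γ' := by
    ext ψ k
    change ψ (k + -(γ.toAdd + γ'.toAdd)) = ψ (k + -γ.toAdd + -γ'.toAdd)
    rw [neg_add, add_assoc]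

/-- The representation of the chains by characters, diagonal in the computational basis. -/
noncomputable def clockRep : Multiplicative (E → ZMod d) →* (Hilb E d ≃ₗᵢ[ℂ] Hilb E d) where
  toFun γ := LinearIsometryEquiv.piLpCongrRight 2 fun k =>
    phase (ZMod.stdAddChar (γ.toAdd ⬝ᵥ k)) (by rw [ZMod.stdAddChar_apply, Circle.norm_coe])
  map_one' := by
    ext ψ k
    simp [phase]
  map_mul' γ γ' := by
    ext ψ k
    simp [phase, AddChar.map_add_eq_mul, add_dotProduct, mul_assoc]

lemma clockRep_single (e : E) :
    clockRep (.ofAdd (Pi.single e 1)) = (siteZ e : Hilb E d ≃ₗᵢ[ℂ] Hilb E d) := by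
  ext ψ k
  simp [clockRep, siteZ, phase, omega_pow_val]

lemma prodX_eq_shiftRep (n : E → ℤ) :
    prodX n = shiftRep (.ofAdd fun e => (n e : ZMod d)) :=
  noncommProd_map_single_zpow shiftRep n _

lemma prodZ_eq_clockRep (n : E → ℤ) :
    prodZ n = clockRep (.ofAdd fun e => (n e : ZMod d)) := by
  simp only [prodZ, ← clockRep_single, noncommProd_map_single_zpow]

lemma stringX_eq_shiftRep (γ : E → ZMod d) : stringX γ = shiftRep (.ofAdd γ) := by
  simp only [stringX, prodX_eq_shiftRep, Int.cast_natCast, ZMod.natCast_zmod_val]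

lemma stringZ_eq_clockRep (γ : E → ZMod d) : stringZ γ = clockRep (.ofAdd γ) := by
  simp only [stringZ, prodZ_eq_clockRep, Int.cast_natCast, ZMod.natCast_zmod_val]

lemma prodX_eq_stringX (n : E → ℤ) : prodX n = stringX fun e => (n e : ZMod d) := by
  rw [prodX_eq_shiftRep, stringX_eq_shiftRep]

lemma prodZ_eq_stringZ (n : E → ℤ) : prodZ n = stringZ fun e => (n e : ZMod d) := by
  rw [prodZ_eq_clockRep, stringZ_eq_clockRep]

lemma stringX_apply (γ : E → ZMod d) (ψ : Hilb E d) (k : E → ZMod d) :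
    stringX γ ψ k = ψ (k - γ) := by
  simp [stringX_eq_shiftRep, shiftRep, LinearIsometryEquiv.piLpCongrLeft_apply,
    Equiv.piCongrLeft', sub_eq_add_neg]

lemma stringZ_apply (γ : E → ZMod d) (ψ : Hilb E d) (k : E → ZMod d) :
    stringZ γ ψ k = ZMod.stdAddChar (γ ⬝ᵥ k) * ψ k := by
  simp [stringZ_eq_clockRep, clockRep, phase]

lemma stringX_pow_card (γ : E → ZMod d) : stringX γ ^ d = 1 := by
  rw [stringX_eq_shiftRep, map_ofAdd_pow_card]

lemma stringZ_pow_card (γ : E → ZMod d) : stringZ γ ^ d = 1 := by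
  rw [stringZ_eq_clockRep, map_ofAdd_pow_card]

lemma stringZ_stringX (γ γ' : E → ZMod d) (ψ : Hilb E d) :
    stringZ γ (stringX γ' ψ) = ZMod.stdAddChar (γ ⬝ᵥ γ') • stringX γ' (stringZ γ ψ) := by
  ext k
  simp only [stringZ_apply, stringX_apply, PiLp.smul_apply, smul_eq_mul, ← mul_assoc,
    ← AddChar.map_add_eq_mul, dotProduct_sub, add_sub_cancel]

end StringOperators

section Span

variable {κ : Type*} [Fintype κ] [DecidableEq κ] {d : ℕ} [NeZero d]

lemma sum_stdAddChar_dotProduct (z : κ → ZMod d) :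
    ∑ y : κ → ZMod d, ZMod.stdAddChar (y ⬝ᵥ z) =
      if z = 0 then (Fintype.card (κ → ZMod d) : ℂ) else 0 := by
  classical
  let χ : AddChar (κ → ZMod d) ℂ :=
    { toFun := fun y => ZMod.stdAddChar (y ⬝ᵥ z)
      map_zero_eq_one' := by rw [zero_dotProduct, AddChar.map_zero_eq_one]
      map_add_eq_mul' := fun y y' => by rw [add_dotProduct, AddChar.map_add_eq_mul] }
  have hχ : χ = 0 ↔ z = 0 := by
    refine ⟨fun h => ?_, fun h => ?_⟩
    · ext i
      have hi : ZMod.stdAddChar (Pi.single i 1 ⬝ᵥ z) = (1 : ℂ) :=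
        DFunLike.congr_fun h (Pi.single i 1)
      rw [single_one_dotProduct, ← AddChar.map_zero_eq_one (ZMod.stdAddChar (N := d))] at hi
      exact ZMod.injective_stdAddChar hi
    · ext y
      change ZMod.stdAddChar (y ⬝ᵥ z) = (1 : ℂ)
      rw [h, dotProduct_zero, AddChar.map_zero_eq_one]
  exact (AddChar.sum_eq_ite χ).trans (by simp only [hχ])

lemma stringX_mul_sum_stringZ (w w' : κ → ZMod d) :
    toEnd (stringX (w' - w)) * ∑ y, ZMod.stdAddChar (-(y ⬝ᵥ w)) • toEnd (stringZ y) =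
      (Fintype.card (κ → ZMod d) : ℂ) • toEuclideanLin (Matrix.single w' w 1) := by
  refine LinearMap.ext fun φ => PiLp.ext fun k => ?_
  set v := k - (w' - w) with hv
  calc (toEnd (stringX (w' - w)) (((∑ y, ZMod.stdAddChar (-(y ⬝ᵥ w)) • toEnd (stringZ y)) :
          Module.End ℂ (Hilb κ d)) φ)) k
      = ∑ y, ZMod.stdAddChar (-(y ⬝ᵥ w)) * (ZMod.stdAddChar (y ⬝ᵥ v) * φ v) := by
        simp [stringX_apply, stringZ_apply, LinearMap.sum_apply, hv]
    _ = (∑ y, ZMod.stdAddChar (y ⬝ᵥ (k - w'))) * φ v := by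
        rw [Finset.sum_mul]
        refine Finset.sum_congr rfl fun y _ => ?_
        rw [← mul_assoc, ← AddChar.map_add_eq_mul, ← dotProduct_neg, ← dotProduct_add,
          show -w + v = k - w' by rw [hv]; abel]
    _ = (Fintype.card (κ → ZMod d) : ℂ) * if k = w' then φ w else 0 := by
        rw [sum_stdAddChar_dotProduct]
        by_cases h : k = w'
        · simp [h, hv]
        · simp [h, sub_eq_zero]
    _ = _ := by
        simp [toLpLin_apply, single_mulVec, Function.update_apply]

theorem span_stringX_mul_stringZ :
    Submodule.span ℂ {O : Module.End ℂ (Hilb κ d) |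
      ∃ u y, O = toEnd (stringX u) * toEnd (stringZ y)} = ⊤ := by
  refine eq_top_iff.2 fun T _ => ?_
  obtain ⟨M, rfl⟩ := toEuclideanLin.surjective T
  rw [matrix_eq_sum_single M]
  simp only [map_sum]
  refine sum_mem fun w' _ => sum_mem fun w _ => ?_
  have hcard : (Fintype.card (κ → ZMod d) : ℂ) ≠ 0 := Nat.cast_ne_zero.2 Fintype.card_ne_zero
  rw [← mul_one (M w' w), ← smul_eq_mul, ← smul_single, map_smul,
    ← inv_smul_smul₀ hcard (toEuclideanLin _), ← stringX_mul_sum_stringZ, Finset.mul_sum]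
  refine Submodule.smul_mem _ _ (Submodule.smul_mem _ _ (sum_mem fun y _ => ?_))
  rw [mul_smul_comm]
  exact Submodule.smul_mem _ _ (Submodule.subset_span ⟨_, _, rfl⟩)

end Span

/-! ### Ground states of sums of contractions -/

section LowestEigenspace

variable {K : Type*} [NormedAddCommGroup K] [InnerProductSpace ℂ K] {ι : Type*} [Fintype ι]
  {A : ι → Module.End ℂ K}

lemma sum_norm_sub_sq_le (hA : ∀ i ψ, ‖A i ψ‖ ≤ ‖ψ‖) {ψ : K} {x : ℝ}
    (hψ : (-∑ i, A i) ψ = (x : ℂ) • ψ) :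
    ∑ i, ‖A i ψ - ψ‖ ^ 2 ≤ 2 * (Fintype.card ι + x) * ‖ψ‖ ^ 2 := by
  have hx : ∑ i, RCLike.re (inner ℂ (A i ψ) ψ) = -x * ‖ψ‖ ^ 2 := by
    have hsum : ∑ i, A i ψ = ((-x : ℝ) : ℂ) • ψ := by
      rw [← LinearMap.sum_apply, Complex.ofReal_neg, neg_smul, ← hψ, LinearMap.neg_apply, neg_neg]
    rw [← map_sum, ← sum_inner, hsum, inner_smul_left, Complex.conj_ofReal]
    exact (Complex.re_ofReal_mul _ _).trans
      (congrArg (-x * ·) (inner_self_eq_norm_sq (𝕜 := ℂ) ψ))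
  calc ∑ i, ‖A i ψ - ψ‖ ^ 2
      ≤ ∑ i, (2 * ‖ψ‖ ^ 2 - 2 * RCLike.re (inner ℂ (A i ψ) ψ)) := by
        refine Finset.sum_le_sum fun i _ => ?_
        have := pow_le_pow_left₀ (norm_nonneg _) (hA i ψ) 2
        rw [norm_sub_sq (𝕜 := ℂ)]
        linarith
    _ = 2 * (Fintype.card ι + x) * ‖ψ‖ ^ 2 := by
        rw [Finset.sum_sub_distrib, ← Finset.mul_sum, ← Finset.mul_sum, hx, Finset.sum_const,
          Finset.card_univ, nsmul_eq_mul]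
        ring

lemma neg_sum_apply_of_forall_apply_eq {ψ : K} (hψ : ∀ i, A i ψ = ψ) :
    (-∑ i, A i) ψ = ((-Fintype.card ι : ℝ) : ℂ) • ψ := by
  simp [LinearMap.sum_apply, hψ, ← Nat.cast_smul_eq_nsmul ℂ]

theorem isLeast_hasEigenvalue_neg_sum (hA : ∀ i ψ, ‖A i ψ‖ ≤ ‖ψ‖) {ψ₀ : K} (hψ₀ : ψ₀ ≠ 0)
    (hfix : ∀ i, A i ψ₀ = ψ₀) :
    IsLeast {x : ℝ | (-∑ i, A i).HasEigenvalue (x : ℂ)} (-Fintype.card ι) := by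
  refine ⟨Module.End.hasEigenvalue_of_hasEigenvector
    ⟨Module.End.mem_eigenspace_iff.2 (neg_sum_apply_of_forall_apply_eq hfix), hψ₀⟩, fun x hx => ?_⟩
  obtain ⟨ψ, hψ, hne⟩ := hx.exists_hasEigenvector
  have hle := sum_norm_sub_sq_le hA (Module.End.mem_eigenspace_iff.1 hψ)
  have hnonneg : 0 ≤ ∑ i, ‖A i ψ - ψ‖ ^ 2 := Finset.sum_nonneg fun i _ => sq_nonneg _
  have hpos : 0 < ‖ψ‖ ^ 2 := by positivity
  nlinarith

theorem mem_eigenspace_neg_sum_iff (hA : ∀ i ψ, ‖A i ψ‖ ≤ ‖ψ‖) {ψ : K} :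
    ψ ∈ (-∑ i, A i).eigenspace ((-Fintype.card ι : ℝ) : ℂ) ↔ ∀ i, A i ψ = ψ := by
  refine Module.End.mem_eigenspace_iff.trans
    ⟨fun hψ i => ?_, neg_sum_apply_of_forall_apply_eq⟩
  have hle : ∑ i, ‖A i ψ - ψ‖ ^ 2 ≤ 0 := by simpa using sum_norm_sub_sq_le hA hψ
  have hzero := (Finset.sum_eq_zero_iff_of_nonneg fun i _ => sq_nonneg _).1
    (hle.antisymm (Finset.sum_nonneg fun i _ => sq_nonneg _)) i (Finset.mem_univ i)
  exact sub_eq_zero.1 (norm_eq_zero.1 (pow_eq_zero_iff two_ne_zero |>.1 hzero))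

end LowestEigenspace

section CyclicAverage

variable {K : Type*} [SeminormedAddCommGroup K] [NormedSpace ℂ K] {d : ℕ} {U : K ≃ₗᵢ[ℂ] K}

/-- The average of the first `d` powers of a unitary, the projection onto its fixed vectors if the
`d`-th power is trivial. -/
noncomputable def cyclicAverage (d : ℕ) (U : K ≃ₗᵢ[ℂ] K) : Module.End ℂ K :=
  (d : ℂ)⁻¹ • ∑ j ∈ Finset.range d, toEnd U ^ j

lemma cyclicAverage_apply (d : ℕ) (U : K ≃ₗᵢ[ℂ] K) (ψ : K) :
    cyclicAverage d U ψ = birkhoffAverage ℂ U id d ψ := by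
  simp [cyclicAverage, birkhoffAverage, birkhoffSum, LinearMap.sum_apply, Module.End.pow_apply]

lemma norm_cyclicAverage_le (d : ℕ) (U : K ≃ₗᵢ[ℂ] K) (ψ : K) :
    ‖cyclicAverage d U ψ‖ ≤ ‖ψ‖ := by
  have hnorm (j : ℕ) : ‖U^[j] ψ‖ = ‖ψ‖ := by
    induction j with
    | zero => rfl
    | succ j ih => rw [Function.iterate_succ_apply', U.norm_map, ih]
  have hsum : ‖birkhoffSum U id d ψ‖ ≤ d * ‖ψ‖ := by
    refine (norm_sum_le _ _).trans_eq ?_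
    simp only [id, hnorm, Finset.sum_const, Finset.card_range, nsmul_eq_mul]
  rw [cyclicAverage_apply, birkhoffAverage, norm_smul, norm_inv, Complex.norm_natCast]
  rcases eq_or_ne d 0 with rfl | hd
  · simp
  · rwa [inv_mul_le_iff₀ (by positivity)]

lemma cyclicAverage_apply_eq_self_iff [NeZero d] (hU : U ^ d = 1) {ψ : K} :
    cyclicAverage d U ψ = ψ ↔ U ψ = ψ := by
  have hiter : U^[d] ψ = ψ := by
    rw [← hom_coe_pow (fun V : K ≃ₗᵢ[ℂ] K => ⇑V) rfl (fun _ _ => rfl), hU]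
    rfl
  rw [cyclicAverage_apply]
  refine ⟨fun h => ?_, fun h => ?_⟩
  · have hinv := birkhoffAverage_apply_sub_birkhoffAverage (R := ℂ) U id d ψ
    rw [id, id, hiter, sub_self, smul_zero, sub_eq_zero] at hinv
    have hcomm : U (birkhoffAverage ℂ U id d ψ) = birkhoffAverage ℂ U id d (U ψ) := by
      rw [map_birkhoffAverage ℂ ℂ]
      refine congrArg _ (Finset.sum_congr rfl fun j _ => ?_)
      exact Function.Commute.self_iterate U j ψ
    rwa [hinv, h] at hcomm
  · exact Function.IsFixedPt.birkhoffAverage_eq ℂ h id (Nat.cast_ne_zero.2 (NeZero.ne d))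

end CyclicAverage

/-! ### The ground space as a code space -/

section Representations

variable {K : Type*} [SeminormedAddCommGroup K] [Module ℂ K] {M : Type*} [AddCommGroup M]

lemma forall_mem_span_apply_eq_iff {d : ℕ} [Module (ZMod d) M]
    (ρ : Multiplicative M →* (K ≃ₗᵢ[ℂ] K)) (s : Set M) (ψ : K) :
    (∀ γ ∈ Submodule.span (ZMod d) s, ρ (.ofAdd γ) ψ = ψ) ↔ ∀ γ ∈ s, ρ (.ofAdd γ) ψ = ψ := by
  let stabilizer : AddSubgroup M :=
    { carrier := {γ | ρ (.ofAdd γ) ψ = ψ}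
      zero_mem' := congrArg (fun U : K ≃ₗᵢ[ℂ] K => U ψ) (map_one ρ)
      add_mem' := fun {γ γ'} (hγ : ρ (.ofAdd γ) ψ = ψ) (hγ' : ρ (.ofAdd γ') ψ = ψ) => by
        change ρ (.ofAdd γ * .ofAdd γ') ψ = ψ
        rw [map_mul, LinearIsometryEquiv.coe_mul, Function.comp_apply, hγ', hγ]
      neg_mem' := fun {γ} (hγ : ρ (.ofAdd γ) ψ = ψ) => by
        change ρ (.ofAdd γ)⁻¹ ψ = ψ
        rw [map_inv]
        exact (LinearIsometryEquiv.symm_apply_eq _).2 hγ.symm }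
  exact Submodule.span_le (p := AddSubgroup.toZModSubmodule d stabilizer)

/-- The restriction of a unitary representation to an invariant subspace. -/
def restrictRep {Γ : Type*} [Group Γ] (ρ : Γ →* (K ≃ₗᵢ[ℂ] K)) (S : Submodule ℂ K)
    (hS : ∀ x, ∀ ψ ∈ S, ρ x ψ ∈ S) : Γ →* (S ≃ₗᵢ[ℂ] S) where
  toFun x :=
    { toLinearEquiv := LinearEquiv.ofLinearMap ((toEnd (ρ x)).restrict (hS x))
        ((toEnd (ρ x⁻¹)).restrict (hS x⁻¹))
        (LinearMap.ext fun ψ => Subtype.ext (by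
          change (ρ x * ρ x⁻¹) (ψ : K) = ψ
          rw [← map_mul, mul_inv_cancel, map_one, LinearIsometryEquiv.coe_one, id_eq]))
        (LinearMap.ext fun ψ => Subtype.ext (by
          change (ρ x⁻¹ * ρ x) (ψ : K) = ψ
          rw [← map_mul, inv_mul_cancel, map_one, LinearIsometryEquiv.coe_one, id_eq]))
      norm_map' := fun ψ => (ρ x).norm_map ψ }
  map_one' := by
    ext ψ
    exact congrArg (fun U : K ≃ₗᵢ[ℂ] K => U ψ) (map_one ρ)
  map_mul' x y := by
    ext ψ
    exact congrArg (fun U : K ≃ₗᵢ[ℂ] K => U ψ) (map_mul ρ x y)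

variable {R : Type*} [Ring R] [Module R M]

/-- The representation of a subquotient `Z / P` on a subspace that is induced by a representation
under which `Z` leaves the subspace invariant and `P` fixes it pointwise. -/
def subquotientRep (ρ : Multiplicative M →* (K ≃ₗᵢ[ℂ] K)) (Z P : Submodule R M)
    (S : Submodule ℂ K) (hZ : ∀ γ ∈ Z, ∀ ψ ∈ S, ρ (.ofAdd γ) ψ ∈ S)
    (hP : ∀ γ ∈ P, ∀ ψ ∈ S, ρ (.ofAdd γ) ψ = ψ) :
    Multiplicative (Z ⧸ P.submoduleOf Z) →* (S ≃ₗᵢ[ℂ] S) :=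
  let ρZ := restrictRep (ρ.comp Z.subtype.toAddMonoidHom.toMultiplicative) S
    fun γ => hZ _ γ.toAdd.2
  AddMonoidHom.toMultiplicativeLeft <|
    QuotientAddGroup.lift (P.submoduleOf Z).toAddSubgroup (MonoidHom.toAdditiveRight ρZ) fun γ hγ =>
      LinearIsometryEquiv.ext fun ψ => Subtype.ext (hP γ hγ ψ ψ.2)

lemma subquotientRep_mk_apply (ρ : Multiplicative M →* (K ≃ₗᵢ[ℂ] K)) {Z P : Submodule R M}
    {S : Submodule ℂ K} (hZ : ∀ γ ∈ Z, ∀ ψ ∈ S, ρ (.ofAdd γ) ψ ∈ S)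
    (hP : ∀ γ ∈ P, ∀ ψ ∈ S, ρ (.ofAdd γ) ψ = ψ) (γ : Z) (ψ : S) :
    (subquotientRep ρ Z P S hZ hP (.ofAdd (Submodule.Quotient.mk γ)) ψ : K) =
      ρ (.ofAdd γ) ψ := rfl

end Representations

lemma forall_mulVec_dotProduct_eq_zero_iff {R m n : Type*} [CommSemiring R] [Fintype m]
    [Fintype n] {A : Matrix m n R} {k : m → R} :
    (∀ c, A *ᵥ c ⬝ᵥ k = 0) ↔ Aᵀ *ᵥ k = 0 := by
  simp only [dotProduct_comm (A *ᵥ _), dotProduct_mulVec, ← mulVec_transpose]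
  exact dotProduct_eq_zero_iff

section CodeSpace

variable {E V F : Type*} [Fintype E] [DecidableEq E] [Fintype V] [Fintype F] {d : ℕ} [NeZero d]
  (D₁ : Matrix V E (ZMod d)) (D₂ : Matrix E F (ZMod d))

/-- The code space of the stabilizer code of a complex with differentials `D₂` and `D₁`: its
stabilizers are the operators `Z` of the boundaries and the operators `X` of the coboundaries. -/
def codeSpace : Submodule ℂ (Hilb E d) where
  carrier := {ψ | (∀ c, stringZ (D₂ *ᵥ c) ψ = ψ) ∧ ∀ c, stringX (D₁ᵀ *ᵥ c) ψ = ψ}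
  zero_mem' := ⟨fun _ => map_zero _, fun _ => map_zero _⟩
  add_mem' hψ hφ := ⟨fun c => by rw [map_add, hψ.1, hφ.1], fun c => by rw [map_add, hψ.2, hφ.2]⟩
  smul_mem' a _ hψ := ⟨fun c => by rw [map_smul, hψ.1], fun c => by rw [map_smul, hψ.2]⟩

variable {D₁ D₂}

lemma stringZ_apply_eq_self_iff {γ : E → ZMod d} {ψ : Hilb E d} :
    stringZ γ ψ = ψ ↔ ∀ k, γ ⬝ᵥ k ≠ 0 → ψ k = 0 := by
  refine ⟨fun h k hk => ?_, fun h => PiLp.ext fun k => ?_⟩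
  · by_contra hne
    have hchar := congrArg (fun φ : Hilb E d => φ k) h
    simp only [stringZ_apply] at hchar
    refine hk (ZMod.injective_stdAddChar ?_)
    rw [(mul_eq_right₀ hne).1 hchar, AddChar.map_zero_eq_one]
  · rw [stringZ_apply]
    rcases eq_or_ne (γ ⬝ᵥ k) 0 with hk | hk
    · rw [hk, AddChar.map_zero_eq_one, one_mul]
    · rw [h k hk, mul_zero]

theorem mem_codeSpace_iff {ψ : Hilb E d} :
    ψ ∈ codeSpace D₁ D₂ ↔
      (∀ k, D₂ᵀ *ᵥ k ≠ 0 → ψ k = 0) ∧ ∀ c k, ψ (k - D₁ᵀ *ᵥ c) = ψ k := by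
  refine and_congr ?_ (forall_congr' fun c => ?_)
  · simp only [stringZ_apply_eq_self_iff]
    rw [forall_comm]
    refine forall_congr' fun k => ?_
    rw [Ne, ← forall_mulVec_dotProduct_eq_zero_iff]
    exact ⟨fun h hk => not_forall.1 hk |>.elim h, fun h c hc => h fun h0 => hc (h0 c)⟩
  · rw [PiLp.ext_iff]
    simp only [stringX_apply]

lemma stringZ_mem_codeSpace {γ : E → ZMod d} (hγ : D₁ *ᵥ γ = 0) {ψ : Hilb E d}
    (hψ : ψ ∈ codeSpace D₁ D₂) : stringZ γ ψ ∈ codeSpace D₁ D₂ := by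
  rw [mem_codeSpace_iff] at hψ ⊢
  refine ⟨fun k hk => by rw [stringZ_apply, hψ.1 k hk, mul_zero], fun c k => ?_⟩
  have horth : γ ⬝ᵥ D₁ᵀ *ᵥ c = 0 := by
    rw [dotProduct_mulVec, vecMul_transpose, hγ, zero_dotProduct]
  rw [stringZ_apply, stringZ_apply, hψ.2, dotProduct_sub, horth, sub_zero]

lemma stringX_mem_codeSpace {γ : E → ZMod d} (hγ : D₂ᵀ *ᵥ γ = 0) {ψ : Hilb E d}
    (hψ : ψ ∈ codeSpace D₁ D₂) : stringX γ ψ ∈ codeSpace D₁ D₂ := by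
  rw [mem_codeSpace_iff] at hψ ⊢
  refine ⟨fun k hk => ?_, fun c k => ?_⟩
  · rw [stringX_apply, hψ.1]
    rwa [mulVec_sub, hγ, sub_zero]
  · rw [stringX_apply, stringX_apply, sub_right_comm, hψ.2]

lemma exists_mem_codeSpace_ne_zero (h : D₁ * D₂ = 0) : ∃ ψ ∈ codeSpace D₁ D₂, ψ ≠ 0 := by
  refine ⟨WithLp.toLp 2 fun k => if D₂ᵀ *ᵥ k = 0 then 1 else 0,
    mem_codeSpace_iff.2 ⟨fun k hk => if_neg hk, fun c k => ?_⟩, fun h0 => ?_⟩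
  · have : D₂ᵀ *ᵥ (D₁ᵀ *ᵥ c) = 0 := by
      rw [mulVec_mulVec, ← transpose_mul, h, transpose_zero, zero_mulVec]
    simp only [mulVec_sub, this, sub_zero]
  · simpa using congrArg (fun φ : Hilb E d => φ 0) h0

end CodeSpace

namespace PolygonDecomposition

variable {E : Type*} [Fintype E] [DecidableEq E] (G : PolygonDecomposition E) {d : ℕ} [NeZero d]

lemma vertexUnitary_eq_stringX (v : G.Vertex) :
    G.vertexUnitary v = stringX ((G.boundaryMatrix₁ (ZMod d))ᵀ.col v) := by
  rw [vertexUnitary, prodX_eq_stringX]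
  congr 1
  ext e
  simp [boundaryMatrix₁_apply]

lemma faceUnitary_eq_stringZ (f : G.Face) :
    G.faceUnitary f = stringZ ((G.boundaryMatrix₂ (ZMod d)).col f) := by
  rw [faceUnitary, prodZ_eq_stringZ]
  congr 1
  ext e
  simp [boundaryMatrix₂_apply]

lemma mem_codeSpace_iff_forall_unitary {ψ : Hilb E d} :
    ψ ∈ codeSpace (G.boundaryMatrix₁ (ZMod d)) (G.boundaryMatrix₂ (ZMod d)) ↔
      (∀ v, G.vertexUnitary v ψ = ψ) ∧ ∀ f, G.faceUnitary f ψ = ψ := by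
  have hX := forall_mem_span_apply_eq_iff (d := d) shiftRep
    (Set.range (G.boundaryMatrix₁ (ZMod d))ᵀ.col) ψ
  have hZ := forall_mem_span_apply_eq_iff (d := d) clockRep
    (Set.range (G.boundaryMatrix₂ (ZMod d)).col) ψ
  rw [← Matrix.range_mulVecLin] at hX hZ
  simp only [LinearMap.mem_range, Set.mem_range, forall_exists_index, forall_apply_eq_imp_iff,
    mulVecLin_apply, ← stringX_eq_shiftRep, ← vertexUnitary_eq_stringX] at hX
  simp only [LinearMap.mem_range, Set.mem_range, forall_exists_index, forall_apply_eq_imp_iff,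
    mulVecLin_apply, ← stringZ_eq_clockRep, ← faceUnitary_eq_stringZ] at hZ
  exact and_comm.trans (and_congr hX hZ)

theorem groundSpace_eq_codeSpace :
    G.groundSpace d = codeSpace (G.boundaryMatrix₁ (ZMod d)) (G.boundaryMatrix₂ (ZMod d)) := by
  let U : G.Vertex ⊕ G.Face → (Hilb E d ≃ₗᵢ[ℂ] Hilb E d) :=
    Sum.elim G.vertexUnitary G.faceUnitary
  have hU (i) : U i ^ d = 1 := by
    rcases i with v | f
    · exact (congrArg (· ^ d) (G.vertexUnitary_eq_stringX v)).trans (stringX_pow_card _)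
    · exact (congrArg (· ^ d) (G.faceUnitary_eq_stringZ f)).trans (stringZ_pow_card _)
  have hH : G.hamiltonian d = -∑ i, cyclicAverage d (U i) := by
    rw [Fintype.sum_sum_type, neg_add, ← sub_eq_add_neg]
    rfl
  have hcontr (i) (ψ : Hilb E d) : ‖cyclicAverage d (U i) ψ‖ ≤ ‖ψ‖ := norm_cyclicAverage_le _ _ _
  have hfix (ψ : Hilb E d) : (∀ i, cyclicAverage d (U i) ψ = ψ) ↔
      ψ ∈ codeSpace (G.boundaryMatrix₁ (ZMod d)) (G.boundaryMatrix₂ (ZMod d)) := by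
    simp only [cyclicAverage_apply_eq_self_iff (hU _), mem_codeSpace_iff_forall_unitary, Sum.forall]
    rfl
  obtain ⟨ψ₀, hψ₀, hne⟩ := exists_mem_codeSpace_ne_zero
    (G.boundaryMatrix₁_mul_boundaryMatrix₂ (R := ZMod d))
  ext ψ
  rw [groundSpace, groundEnergy, hH,
    (isLeast_hasEigenvalue_neg_sum hcontr hne ((hfix ψ₀).2 hψ₀)).csInf_eq,
    mem_eigenspace_neg_sum_iff hcontr, hfix]

end PolygonDecomposition

/-! ### Labels and tensor products of matrix algebras -/

section ZModModule

variable {d : ℕ} {M : Type*} [AddCommGroup M] [Module (ZMod d) M]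

lemma toZModSubmodule_closure (s : Set M) :
    AddSubgroup.toZModSubmodule d (AddSubgroup.closure s) = Submodule.span (ZMod d) s :=
  (Submodule.span_le.2 AddSubgroup.subset_closure).antisymm'
    ((Submodule.span (ZMod d) s).toAddSubgroup.closure_le.2 Submodule.subset_span)

lemma closure_eq_top_iff_span_eq_top {s : Set M} :
    AddSubgroup.closure s = ⊤ ↔ Submodule.span (ZMod d) s = ⊤ := by
  rw [← toZModSubmodule_closure, map_eq_top_iff]

/- The ranks themselves may differ: every module over `ZMod 1` has rank `0`. -/
theorem pow_rank_eq_pow_card [NeZero d] [AddGroup.FG M] {κ : Type*} [Fintype κ]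
    (b : Module.Basis κ (ZMod d) M) : d ^ AddGroup.rank M = d ^ Fintype.card κ := by
  classical
  apply le_antisymm
  · refine Nat.pow_le_pow_right (NeZero.pos d) ?_
    refine (AddGroup.rank_le (S := Finset.univ.image b) ?_).trans Finset.card_image_le
    rw [closure_eq_top_iff_span_eq_top (d := d), Finset.coe_image, Finset.coe_univ, Set.image_univ,
      b.span_eq]
  · obtain ⟨S, hS, hgen⟩ := AddGroup.rank_spec M
    rw [closure_eq_top_iff_span_eq_top (d := d)] at hgen
    have hsurj : Function.Surjective (Fintype.linearCombination (ZMod d) ((↑) : S → M)) := by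
      rw [← LinearMap.range_eq_top, Fintype.range_linearCombination, Subtype.range_coe]
      exact hgen
    have hcard := Nat.card_le_card_of_surjective _ (b.equivFun.surjective.comp hsurj)
    simpa [Nat.card_eq_fintype_card, ZMod.card, hS] using hcard

end ZModModule

section Labels

lemma existsUnique_dotProduct_eq {R A A' ι : Type*} [CommRing R] [AddCommGroup A] [Module R A]
    [AddCommGroup A'] [Module R A'] [Fintype ι] (θ : A' ≃ₗ[R] Module.Dual R A)
    (L : A ≃ₗ[R] (ι → R)) : ∃! M : A' ≃ₗ[R] (ι → R), ∀ a b, L a ⬝ᵥ M b = θ b a := by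
  classical
  refine ⟨θ ≪≫ₗ L.symm.dualMap ≪≫ₗ (dotProductEquiv R ι).symm, fun a b => ?_, fun M hM => ?_⟩
  · have h := LinearMap.congr_fun
      ((dotProductEquiv R ι).apply_symm_apply (L.symm.dualMap (θ b))) (L a)
    exact (dotProduct_comm _ _).trans (h.trans (congrArg (θ b) (L.symm_apply_apply a)))
  · ext b i
    have h := hM (L.symm (Pi.single i 1)) b
    rw [L.apply_symm_apply, single_dotProduct, one_mul] at h
    simpa using h

variable {g d : ℕ}

/-- The hyperbolic form on labels, as an identification of the labels with their dual. -/
noncomputable def labelDual : Label g d ≃ₗ[ZMod d] Module.Dual (ZMod d) (Label g d) :=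
  LinearEquiv.prodComm (ZMod d) _ _ ≪≫ₗ
    (dotProductEquiv (ZMod d) (Fin g)).prodCongr (dotProductEquiv (ZMod d) (Fin g)) ≪≫ₗ
    Module.dualProdDualEquivDual (ZMod d) _ _

lemma labelDual_apply (a b : Label g d) : labelDual a b = a.2 ⬝ᵥ b.1 + a.1 ⬝ᵥ b.2 := rfl

lemma labelDual_comm (a b : Label g d) : labelDual a b = labelDual b a := by
  rw [labelDual_apply, labelDual_apply, dotProduct_comm a.1, dotProduct_comm a.2, add_comm]

lemma eq_labelDual_iff (B : Label g d →ₗ[ZMod d] Module.Dual (ZMod d) (Label g d)) :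
    (∀ a b, B a b = labelDual a b) ↔ ∀ i j,
      B (lab₁ i) (lab₁ j) = 0 ∧ B (lab₂ i) (lab₂ j) = 0 ∧
      B (lab₁ i) (lab₂ j) = (Pi.single i 1 : Fin g → ZMod d) j ∧
      B (lab₂ i) (lab₁ j) = (Pi.single i 1 : Fin g → ZMod d) j := by
  refine ⟨fun h i j => by simp [h, labelDual_apply, lab₁, lab₂], fun h => ?_⟩
  suffices B = labelDual.toLinearMap from fun a b => by rw [this]; rfl
  ext i j
  · exact (h i j).1.trans (by simp [labelDual_apply])
  · exact (h i j).2.2.1.trans (by simp [labelDual_apply])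
  · exact (h i j).2.2.2.trans (by simp [labelDual_apply])
  · exact (h i j).2.1.trans (by simp [labelDual_apply])

lemma closure_labels [NeZero d] :
    AddSubmonoid.closure (Set.range lab₁ ∪ Set.range lab₂ : Set (Label g d)) = ⊤ := by
  let b := (Pi.basisFun (ZMod d) (Fin g)).prod (Pi.basisFun (ZMod d) (Fin g))
  have hb : ⇑b = Sum.elim lab₁ lab₂ := by
    ext (i | i) <;> simp [b, lab₁, lab₂]
  rw [← Set.Sum.elim_range, ← hb, ← AddSubgroup.closure_toAddSubmonoid_of_finite,
    closure_eq_top_iff_span_eq_top (d := d) |>.2 b.span_eq, AddSubgroup.top_toAddSubmonoid]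

/-- Pairs of vectors of length `g` as vectors of length `2 * g`. -/
def labelEquiv (g d : ℕ) : Label g d ≃ₗ[ZMod d] (Fin (2 * g) → ZMod d) :=
  (LinearEquiv.sumArrowLequivProdArrow (Fin g) (Fin g) (ZMod d) (ZMod d)).symm ≪≫ₗ
    LinearEquiv.funCongrLeft (ZMod d) (ZMod d)
      ((finCongr (two_mul g)).trans finSumFinEquiv.symm)

end Labels

section KroneckerProduct

variable {R ι : Type*} {κ : ι → Type*} [CommRing R] [Fintype ι]

/-- The Kronecker product of a family of square matrices. -/
def piKronecker : MultilinearMap R (fun i => Matrix (κ i) (κ i) R)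
    (Matrix (∀ i, κ i) (∀ i, κ i) R) :=
  (Matrix.ofLinearEquiv R).toLinearMap.compMultilinearMap <|
    MultilinearMap.pi fun a => MultilinearMap.pi fun b =>
      (MultilinearMap.mkPiAlgebra R ι R).compLinearMap fun i =>
        Matrix.entryLinearMap R R (a i) (b i)

lemma piKronecker_apply (M : ∀ i, Matrix (κ i) (κ i) R) (a b : ∀ i, κ i) :
    piKronecker M a b = ∏ i, M i (a i) (b i) := rfl

variable [∀ i, Fintype (κ i)] [∀ i, DecidableEq (κ i)] [DecidableEq ι]

theorem nonempty_piTensorProduct_matrix_algEquiv :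
    Nonempty ((⨂[R] i, Matrix (κ i) (κ i) R) ≃ₐ[R] Matrix (∀ i, κ i) (∀ i, κ i) R) := by
  have hone : piKronecker (1 : ∀ i, Matrix (κ i) (κ i) R) = 1 := by
    ext a b
    simp [piKronecker_apply, Matrix.one_apply, Fintype.prod_ite_zero, funext_iff]
  have hmul (M N : ∀ i, Matrix (κ i) (κ i) R) :
      piKronecker (M * N) = piKronecker M * piKronecker N := by
    ext a b
    simp only [piKronecker_apply, Pi.mul_apply, Matrix.mul_apply, Finset.prod_univ_sum,
      Fintype.piFinset_univ, Finset.prod_mul_distrib]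
  let f : (⨂[R] i, Matrix (κ i) (κ i) R) →ₐ[R] Matrix (∀ i, κ i) (∀ i, κ i) R :=
    PiTensorProduct.liftAlgHom piKronecker hone hmul
  let e := (Basis.piTensorProduct fun i => Matrix.stdBasis R (κ i) (κ i)).equiv
    (Matrix.stdBasis R (∀ i, κ i) (∀ i, κ i)) (Equiv.arrowProdEquivProdArrow ι κ κ)
  have hfe : f.toLinearMap = e.toLinearMap := by
    refine Module.Basis.ext (Basis.piTensorProduct fun i =>
      Matrix.stdBasis R (κ i) (κ i)) fun p => Matrix.ext fun a b => ?_
    obtain ⟨⟨u, v⟩, rfl⟩ := (Equiv.arrowProdEquivProdArrow ι κ κ).symm.surjective p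
    have he := (Basis.piTensorProduct fun i => Matrix.stdBasis R (κ i) (κ i)).equiv_apply
      ((Equiv.arrowProdEquivProdArrow ι κ κ).symm (u, v)) (Matrix.stdBasis R (∀ i, κ i) (∀ i, κ i))
      (Equiv.arrowProdEquivProdArrow ι κ κ)
    rw [LinearEquiv.coe_coe, he, Equiv.apply_symm_apply, Basis.piTensorProduct_apply]
    simp [f, Matrix.stdBasis_eq_single, Matrix.single_apply, piKronecker_apply,
      Fintype.prod_ite_zero, funext_iff, forall_and]
  refine ⟨AlgEquiv.ofBijective f ?_⟩
  rw [← AlgHom.coe_toLinearMap, hfe]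
  exact e.bijective

end KroneckerProduct

lemma algebraOn_eq_top {H : Type*} [AddCommGroup H] [Module ℂ H] (K : Submodule ℂ H) :
    algebraOn K = ⊤ := by
  refine eq_top_iff.2 fun T _ => ?_
  obtain ⟨p, hp⟩ := LinearMap.exists_leftInverse_of_injective K.subtype (Submodule.ker_subtype K)
  have hpK (ψ : K) : p ψ = ψ := LinearMap.congr_fun hp ψ
  exact ⟨⟨K.subtype ∘ₗ T ∘ₗ p, fun ψ _ => (T (p ψ)).2⟩,
    LinearMap.ext fun ψ => Subtype.ext (congrArg (fun φ => (T φ : H)) (hpK ψ))⟩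

/-! ### Logical qudits -/

/-- Qudits of dimension `d`, indexed by `κ`, encoded in a space `S` on which groups `H` and `H'` act
unitarily: coordinates on `H`, `H'` and `S` in which the elements of `H` act as the operators
`stringZ` and those of `H'` as the operators `stringX`. -/
structure LogicalQudits (S H H' κ : Type*) (d : ℕ) [SeminormedAddCommGroup S] [Module ℂ S]
    [AddCommGroup H] [Module (ZMod d) H] [AddCommGroup H'] [Module (ZMod d) H'] [Fintype κ]
    [DecidableEq κ] [NeZero d] where
  repZ : Multiplicative H →* (S ≃ₗᵢ[ℂ] S)
  repX : Multiplicative H' →* (S ≃ₗᵢ[ℂ] S)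
  coordZ : H ≃ₗ[ZMod d] (κ → ZMod d)
  coordX : H' ≃ₗ[ZMod d] (κ → ZMod d)
  decode : S ≃ₗ[ℂ] Hilb κ d
  decode_repZ : ∀ c ψ, decode (repZ (.ofAdd c) ψ) = stringZ (coordZ c) (decode ψ)
  decode_repX : ∀ c ψ, decode (repX (.ofAdd c) ψ) = stringX (coordX c) (decode ψ)

lemma gcomm_map_eq_one {A U : Type*} [CommGroup A] [Group U] (ρ : A →* U) (a b : A) :
    gcomm (ρ a) (ρ b) = 1 := by
  rw [gcomm, ← map_mul, mul_comm, map_mul, mul_inv_cancel_right, mul_inv_cancel]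

lemma toEnd_mem_of_forall_lab {S A : Type*} [SeminormedAddCommGroup S] [Module ℂ S]
    [AddCommGroup A] {g d : ℕ} [NeZero d] (ρ : Multiplicative A →* (S ≃ₗᵢ[ℂ] S))
    (Φ : Label g d ≃+ A) {𝒜 : Subalgebra ℂ (Module.End ℂ S)}
    (h : ∀ i, toEnd (ρ (.ofAdd (Φ (lab₁ i)))) ∈ 𝒜 ∧ toEnd (ρ (.ofAdd (Φ (lab₂ i)))) ∈ 𝒜) (a : A) :
    toEnd (ρ (.ofAdd a)) ∈ 𝒜 := by
  obtain ⟨b, rfl⟩ := Φ.surjective a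
  have hb : b ∈ AddSubmonoid.closure (Set.range lab₁ ∪ Set.range lab₂ : Set (Label g d)) := by
    rw [closure_labels]
    exact AddSubmonoid.mem_top b
  induction hb using AddSubmonoid.closure_induction with
  | mem b hb =>
    rcases hb with ⟨i, rfl⟩ | ⟨i, rfl⟩
    exacts [(h i).1, (h i).2]
  | zero =>
    rw [map_zero, ofAdd_zero, map_one]
    exact one_mem 𝒜
  | add b c _ _ hb hc =>
    rw [map_add, ofAdd_add, map_mul]
    exact mul_mem hb hc

namespace LogicalQudits

variable {S H H' κ : Type*} {d : ℕ} [SeminormedAddCommGroup S] [Module ℂ S] [AddCommGroup H]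
  [Module (ZMod d) H] [AddCommGroup H'] [Module (ZMod d) H'] [Fintype κ] [DecidableEq κ] [NeZero d]
  (Q : LogicalQudits S H H' κ d)
include Q

theorem finrank_eq : Module.finrank ℂ S = d ^ Fintype.card κ := by
  rw [Q.decode.finrank_eq, finrank_euclideanSpace, Fintype.card_fun, ZMod.card]

theorem finrank_eq_pow_rank [AddGroup.FG H] : Module.finrank ℂ S = d ^ AddGroup.rank H := by
  rw [Q.finrank_eq, pow_rank_eq_pow_card (Module.Basis.ofEquivFun Q.coordZ)]

lemma nontrivial : Nontrivial S := Q.decode.symm.injective.nontrivial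

theorem span_eq_top :
    Submodule.span ℂ {O : Module.End ℂ S |
      ∃ c' c, O = toEnd (Q.repX (.ofAdd c')) * toEnd (Q.repZ (.ofAdd c))} = ⊤ := by
  have h := congrArg (Submodule.map Q.decode.symm.conj.toLinearMap)
    (span_stringX_mul_stringZ (κ := κ) (d := d))
  rw [Submodule.map_span, Submodule.map_top, LinearEquiv.range] at h
  rw [eq_top_iff, ← h]
  refine Submodule.span_mono ?_
  rintro _ ⟨_, ⟨u, y, rfl⟩, rfl⟩
  refine ⟨Q.coordX.symm u, Q.coordZ.symm y, LinearMap.ext fun ψ => Q.decode.injective ?_⟩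
  simp [LinearEquiv.conj_apply, Q.decode_repZ, Q.decode_repX]

theorem span_apply_eq_top {ψ : S} (hψ : ψ ≠ 0) :
    Submodule.span ℂ {φ : S | ∃ c' c, φ = Q.repX (.ofAdd c') (Q.repZ (.ofAdd c) ψ)} = ⊤ := by
  refine eq_top_iff.2 fun φ _ => ?_
  obtain ⟨O, hO⟩ : ∃ O : Module.End ℂ S, O ψ = φ := by
    obtain ⟨f, hf⟩ := Module.Projective.exists_dual_eq_one ℂ hψ
    exact ⟨f.smulRight φ, by rw [LinearMap.smulRight_apply, hf, one_smul]⟩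
  have hmem := Submodule.mem_map_of_mem (f := LinearMap.applyₗ (R := ℂ) ψ)
    (Q.span_eq_top ▸ Submodule.mem_top : O ∈ _)
  rw [Submodule.map_span, LinearMap.applyₗ_apply_apply, hO] at hmem
  refine Submodule.span_mono ?_ hmem
  rintro _ ⟨_, ⟨c', c, rfl⟩, rfl⟩
  exact ⟨c', c, rfl⟩

lemma repZ_repX (c : H) (c' : H') (ψ : S) :
    Q.repZ (.ofAdd c) (Q.repX (.ofAdd c') ψ) =
      (ZMod.stdAddChar (Q.coordZ c ⬝ᵥ Q.coordX c') : ℂ) •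
        Q.repX (.ofAdd c') (Q.repZ (.ofAdd c) ψ) :=
  Q.decode.injective <| by
    simp only [map_smul, Q.decode_repZ, Q.decode_repX, stringZ_stringX]

lemma toEnd_gcomm (c : H) (c' : H') :
    toEnd (gcomm (Q.repZ (.ofAdd c)) (Q.repX (.ofAdd c'))) =
      (ZMod.stdAddChar (Q.coordZ c ⬝ᵥ Q.coordX c') : ℂ) • (1 : Module.End ℂ S) := by
  refine LinearMap.ext fun ψ => ?_
  set A := Q.repZ (.ofAdd c)
  set B := Q.repX (.ofAdd c')
  change A (B (A⁻¹ (B⁻¹ ψ))) = _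
  rw [Q.repZ_repX]
  change _ • (B * (A * A⁻¹) * B⁻¹) ψ = _
  rw [mul_inv_cancel, mul_one, mul_inv_cancel]
  rfl

lemma toEnd_gcomm_eq_smul_iff {c : H} {c' : H'} {z : ZMod d} :
    toEnd (gcomm (Q.repZ (.ofAdd c)) (Q.repX (.ofAdd c'))) =
      (ZMod.stdAddChar z : ℂ) • (1 : Module.End ℂ S) ↔ Q.coordZ c ⬝ᵥ Q.coordX c' = z := by
  have := Q.nontrivial
  rw [toEnd_gcomm, (smul_left_injective ℂ one_ne_zero).eq_iff, ZMod.injective_stdAddChar.eq_iff]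

lemma gcomm_eq_one_iff {c : H} {c' : H'} :
    gcomm (Q.repZ (.ofAdd c)) (Q.repX (.ofAdd c')) = 1 ↔ Q.coordZ c ⬝ᵥ Q.coordX c' = 0 := by
  rw [← Q.toEnd_gcomm_eq_smul_iff, AddChar.map_zero_eq_one, one_smul]
  exact (LinearIsometryEquiv.toLinearEquiv_injective.eq_iff.symm.trans
    LinearEquiv.toLinearMap_injective.eq_iff.symm)

section Labellings

variable {g : ℕ}

lemma weylRelations_iff_coord_lab (Φ : Label g d ≃+ H) (Φ' : Label g d ≃+ H') :
    WeylRelations (fun a => Q.repZ (.ofAdd (Φ a))) (fun a => Q.repX (.ofAdd (Φ' a))) ↔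
      ∀ i j, Q.coordZ (Φ (lab₁ i)) ⬝ᵥ Q.coordX (Φ' (lab₁ j)) = 0 ∧
        Q.coordZ (Φ (lab₂ i)) ⬝ᵥ Q.coordX (Φ' (lab₂ j)) = 0 ∧
        Q.coordZ (Φ (lab₁ i)) ⬝ᵥ Q.coordX (Φ' (lab₂ j)) = (Pi.single i 1 : Fin g → ZMod d) j ∧
        Q.coordZ (Φ (lab₂ i)) ⬝ᵥ Q.coordX (Φ' (lab₁ j)) =
          (Pi.single i 1 : Fin g → ZMod d) j := by
  constructor
  · intro h i j
    refine ⟨Q.gcomm_eq_one_iff.1 (h.comm₁₁ i j), Q.gcomm_eq_one_iff.1 (h.comm₂₂ i j), ?_⟩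
    rcases eq_or_ne i j with rfl | hij
    · rw [Pi.single_eq_same, ← Q.toEnd_gcomm_eq_smul_iff, ← Q.toEnd_gcomm_eq_smul_iff,
        ← omega_eq_stdAddChar]
      exact ⟨h.comm₁₂ i, h.comm₂₁ i⟩
    · rw [Pi.single_eq_of_ne' hij, ← Q.gcomm_eq_one_iff, ← Q.gcomm_eq_one_iff]
      exact ⟨h.comm₁₂_ne i j hij, h.comm₂₁_ne i j hij⟩
  · intro h
    exact
      { comm₁₂ := fun i => by
          rw [omega_eq_stdAddChar, Q.toEnd_gcomm_eq_smul_iff, (h i i).2.2.1, Pi.single_eq_same]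
        comm₂₁ := fun i => by
          rw [omega_eq_stdAddChar, Q.toEnd_gcomm_eq_smul_iff, (h i i).2.2.2, Pi.single_eq_same]
        comm₁₂_ne := fun i j hij => by
          rw [Q.gcomm_eq_one_iff, (h i j).2.2.1, Pi.single_eq_of_ne' hij]
        comm₂₁_ne := fun i j hij => by
          rw [Q.gcomm_eq_one_iff, (h i j).2.2.2, Pi.single_eq_of_ne' hij]
        comm₁₁ := fun i j => Q.gcomm_eq_one_iff.2 (h i j).1
        comm₂₂ := fun i j => Q.gcomm_eq_one_iff.2 (h i j).2.1
        commZ := fun _ _ => by simp only [gcomm_map_eq_one, and_self]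
        commX := fun _ _ => by simp only [gcomm_map_eq_one, and_self] }

theorem weylRelations_iff (Φ : Label g d ≃+ H) (Φ' : Label g d ≃+ H') :
    WeylRelations (fun a => Q.repZ (.ofAdd (Φ a))) (fun a => Q.repX (.ofAdd (Φ' a))) ↔
      ∀ a b, Q.coordZ (Φ a) ⬝ᵥ Q.coordX (Φ' b) = labelDual a b :=
  let B : Label g d →ₗ[ZMod d] Module.Dual (ZMod d) (Label g d) :=
    (dotProductBilin (ZMod d) (ZMod d)).compl₁₂
      (Q.coordZ.toLinearMap ∘ₗ Φ.toAddMonoidHom.toZModLinearMap d)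
      (Q.coordX.toLinearMap ∘ₗ Φ'.toAddMonoidHom.toZModLinearMap d)
  (Q.weylRelations_iff_coord_lab Φ Φ').trans (eq_labelDual_iff B).symm

theorem existsUnique_weylRelations (Φ : Label g d ≃+ H) :
    ∃! Φ' : Label g d ≃+ H',
      WeylRelations (fun a => Q.repZ (.ofAdd (Φ a))) (fun a => Q.repX (.ofAdd (Φ' a))) := by
  obtain ⟨M, hM, huniq⟩ := existsUnique_dotProduct_eq (labelDual (g := g) (d := d))
    ((Φ.toLinearEquiv (ZMod.map_smul Φ)).trans Q.coordZ)
  refine ⟨(M.trans Q.coordX.symm).toAddEquiv,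
    (Q.weylRelations_iff _ _).2 fun a b => ?_, fun Φ' hΦ' => ?_⟩
  · rw [labelDual_comm, ← hM]
    exact congrArg (Q.coordZ (Φ a) ⬝ᵥ ·) (Q.coordX.apply_symm_apply (M b))
  · have hΦM := huniq ((Φ'.toLinearEquiv (ZMod.map_smul Φ')).trans Q.coordX) fun a b =>
      ((Q.weylRelations_iff _ _).1 hΦ' a b).trans (labelDual_comm a b)
    rw [← hΦM]
    ext b
    exact (Q.coordX.symm_apply_apply (Φ' b)).symm

theorem adjoin_eq_top (Φ : Label g d ≃+ H) (Φ' : Label g d ≃+ H') :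
    Algebra.adjoin ℂ (⋃ i : Fin g,
      {toEnd (Q.repX (.ofAdd (Φ' (lab₁ i)))), toEnd (Q.repX (.ofAdd (Φ' (lab₂ i)))),
        toEnd (Q.repZ (.ofAdd (Φ (lab₁ i)))), toEnd (Q.repZ (.ofAdd (Φ (lab₂ i))))} :
      Set (Module.End ℂ S)) = ⊤ := by
  set 𝒜 := Algebra.adjoin ℂ (⋃ i : Fin g,
    {toEnd (Q.repX (.ofAdd (Φ' (lab₁ i)))), toEnd (Q.repX (.ofAdd (Φ' (lab₂ i)))),
      toEnd (Q.repZ (.ofAdd (Φ (lab₁ i)))), toEnd (Q.repZ (.ofAdd (Φ (lab₂ i))))} :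
    Set (Module.End ℂ S)) with h𝒜
  have hgen (i : Fin g) : _ ⊆ (𝒜 : Set (Module.End ℂ S)) :=
    (Set.subset_iUnion _ i).trans (h𝒜 ▸ Algebra.subset_adjoin)
  simp only [Set.insert_subset_iff, Set.singleton_subset_iff, SetLike.mem_coe] at hgen
  rw [← Algebra.toSubmodule_eq_top, eq_top_iff, ← Q.span_eq_top, Submodule.span_le]
  rintro _ ⟨c', c, rfl⟩
  exact 𝒜.mul_mem
    (toEnd_mem_of_forall_lab Q.repX Φ' (fun i => ⟨(hgen i).1, (hgen i).2.1⟩) c')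
    (toEnd_mem_of_forall_lab Q.repZ Φ (fun i => (hgen i).2.2) c)

end Labellings

theorem nonempty_algEquiv :
    Nonempty (Module.End ℂ S ≃ₐ[ℂ] ⨂[ℂ] _ : κ, Matrix (Fin d) (Fin d) ℂ) := by
  obtain ⟨kronecker⟩ :=
    nonempty_piTensorProduct_matrix_algEquiv (R := ℂ) (ι := κ) (κ := fun _ => Fin d)
  let digits : (κ → ZMod d) ≃ (κ → Fin d) :=
    Equiv.piCongrRight fun _ => (ZMod.finEquiv d).toEquiv.symm
  let coord : S ≃ₗ[ℂ] ((κ → ZMod d) → ℂ) := Q.decode ≪≫ₗ WithLp.linearEquiv 2 ℂ _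
  exact ⟨(coord.conjAlgEquiv ℂ).trans <| LinearMap.toMatrixAlgEquiv'.trans <|
    (Matrix.reindexAlgEquiv ℂ ℂ digits).trans kronecker.symm⟩

end LogicalQudits

/-! ### The logical qudits of a polygon decomposition -/

namespace HomologySplitting

variable {E V F κ : Type*} [Fintype E] [DecidableEq E] [Fintype V] [Fintype F] [Fintype κ]
  [DecidableEq κ] {d : ℕ} [NeZero d] {D₁ : Matrix V E (ZMod d)} {D₂ : Matrix E F (ZMod d)}
  (σ : HomologySplitting D₁ D₂ κ)

lemma apply_transpose_proj_transpose_incl {ψ : Hilb E d} (hψ : ψ ∈ codeSpace D₁ D₂)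
    {k : E → ZMod d} (hk : D₂ᵀ *ᵥ k = 0) : ψ (σ.projᵀ *ᵥ (σ.inclᵀ *ᵥ k)) = ψ k := by
  have hsplit := σ.transpose.eq_incl_add_of_mulVec_eq_zero hk
  rw [← (mem_codeSpace_iff.1 hψ).2 (σ.homotopy₀ᵀ *ᵥ k) k]
  exact congrArg ψ (eq_sub_of_add_eq hsplit.symm)

/-- The code space as the space of functions of the cohomology coordinates: a code vector is
supported on the cocycles and depends only on cohomology classes. -/
noncomputable def codeSpaceEquiv : codeSpace D₁ D₂ ≃ₗ[ℂ] Hilb κ d where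
  toFun ψ := WithLp.toLp 2 fun w => (ψ : Hilb E d) (σ.projᵀ *ᵥ w)
  map_add' _ _ := rfl
  map_smul' _ _ := rfl
  invFun φ :=
    ⟨WithLp.toLp 2 fun k => if D₂ᵀ *ᵥ k = 0 then φ (σ.inclᵀ *ᵥ k) else 0,
      mem_codeSpace_iff.2 ⟨fun k hk => if_neg hk, fun c k => by
        have hcocycle : D₂ᵀ *ᵥ (D₁ᵀ *ᵥ c) = 0 := by
          rw [mulVec_mulVec, σ.transpose.mul_eq_zero, zero_mulVec]
        have hexact : σ.inclᵀ *ᵥ (D₁ᵀ *ᵥ c) = 0 := σ.transpose.proj_mulVec_mulVec c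
        simp only [mulVec_sub, hcocycle, hexact, sub_zero]⟩⟩
  left_inv ψ := by
    ext k
    by_cases hk : D₂ᵀ *ᵥ k = 0
    · exact (if_pos hk).trans (σ.apply_transpose_proj_transpose_incl ψ.2 hk)
    · exact (if_neg hk).trans ((mem_codeSpace_iff.1 ψ.2).1 k hk).symm
  right_inv φ := by
    ext w
    exact (if_pos (σ.transpose.mulVec_incl_mulVec w)).trans
      (congrArg φ (σ.transpose.proj_mulVec_incl_mulVec w))

lemma codeSpaceEquiv_apply (ψ : codeSpace D₁ D₂) (w : κ → ZMod d) :
    σ.codeSpaceEquiv ψ w = (ψ : Hilb E d) (σ.projᵀ *ᵥ w) := rfl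

/-- The qudits encoded in the code space, one for each coordinate on the homology. -/
noncomputable def logicalQudits :
    LogicalQudits (codeSpace D₁ D₂)
      (LinearMap.ker D₁.mulVecLin ⧸
        (LinearMap.range D₂.mulVecLin).submoduleOf (LinearMap.ker D₁.mulVecLin))
      (LinearMap.ker D₂ᵀ.mulVecLin ⧸
        (LinearMap.range D₁ᵀ.mulVecLin).submoduleOf (LinearMap.ker D₂ᵀ.mulVecLin)) κ d where
  repZ := subquotientRep clockRep _ _ _
    (fun γ hγ ψ hψ => stringZ_eq_clockRep γ ▸ stringZ_mem_codeSpace hγ hψ)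
    (by
      rintro _ ⟨c, rfl⟩ ψ hψ
      exact stringZ_eq_clockRep (D₂ *ᵥ c) ▸ hψ.1 c)
  repX := subquotientRep shiftRep _ _ _
    (fun γ hγ ψ hψ => stringX_eq_shiftRep γ ▸ stringX_mem_codeSpace hγ hψ)
    (by
      rintro _ ⟨c, rfl⟩ ψ hψ
      exact stringX_eq_shiftRep (D₁ᵀ *ᵥ c) ▸ hψ.2 c)
  coordZ := σ.homologyEquiv
  coordX := σ.transpose.homologyEquiv
  decode := σ.codeSpaceEquiv
  decode_repZ c ψ := by
    obtain ⟨γ, rfl⟩ := Submodule.Quotient.mk_surjective _ c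
    ext w
    rw [codeSpaceEquiv_apply, subquotientRep_mk_apply, ← stringZ_eq_clockRep, stringZ_apply,
      dotProduct_mulVec, vecMul_transpose, stringZ_apply, homologyEquiv_mk, codeSpaceEquiv_apply]
  decode_repX c ψ := by
    obtain ⟨γ, rfl⟩ := Submodule.Quotient.mk_surjective _ c
    ext w
    have hcocycle : D₂ᵀ *ᵥ (σ.projᵀ *ᵥ w - γ) = 0 := by
      rw [mulVec_sub, show D₂ᵀ *ᵥ γ = 0 from γ.2, sub_zero]
      exact σ.transpose.mulVec_incl_mulVec w
    have hcoord : σ.inclᵀ *ᵥ (σ.projᵀ *ᵥ w - γ) = w - σ.inclᵀ *ᵥ γ := by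
      rw [mulVec_sub]
      exact congrArg (· - _) (σ.transpose.proj_mulVec_incl_mulVec w)
    rw [codeSpaceEquiv_apply, subquotientRep_mk_apply, ← stringX_eq_shiftRep, stringX_apply,
      ← σ.apply_transpose_proj_transpose_incl ψ.2 hcocycle, hcoord]
    exact (stringX_apply (σ.inclᵀ *ᵥ γ) (σ.codeSpaceEquiv ψ) w).symm

include σ in
theorem exists_logicalQudits {S : Submodule ℂ (Hilb E d)}
    {Z P Z' P' : Submodule (ZMod d) (E → ZMod d)} (hS : S = codeSpace D₁ D₂)
    (hZ : Z = LinearMap.ker D₁.mulVecLin) (hP : P = LinearMap.range D₂.mulVecLin)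
    (hZ' : Z' = LinearMap.ker D₂ᵀ.mulVecLin) (hP' : P' = LinearMap.range D₁ᵀ.mulVecLin) :
    ∃ Q : LogicalQudits S (Z ⧸ P.submoduleOf Z) (Z' ⧸ P'.submoduleOf Z') κ d,
      (∀ (γ : Z) (ψ : S), (Q.repZ (.ofAdd (Submodule.Quotient.mk γ)) ψ : Hilb E d) =
        stringZ (γ : E → ZMod d) ψ) ∧
      ∀ (γ : Z') (ψ : S), (Q.repX (.ofAdd (Submodule.Quotient.mk γ)) ψ : Hilb E d) =
        stringX (γ : E → ZMod d) ψ := by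
  subst hS hZ hP hZ' hP'
  refine ⟨σ.logicalQudits, fun γ ψ => ?_, fun γ ψ => ?_⟩
  · rw [stringZ_eq_clockRep]
    rfl
  · rw [stringX_eq_shiftRep]
    rfl

end HomologySplitting

theorem LogicalQudits.span_stringX_stringZ_eq {E κ : Type*} [Fintype E] [DecidableEq E] [Fintype κ]
    [DecidableEq κ] {d : ℕ} [NeZero d] {S : Submodule ℂ (Hilb E d)}
    {Z P Z' P' : Submodule (ZMod d) (E → ZMod d)}
    (Q : LogicalQudits S (Z ⧸ P.submoduleOf Z) (Z' ⧸ P'.submoduleOf Z') κ d)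
    (hZ : ∀ (γ : Z) (ψ : S), (Q.repZ (.ofAdd (Submodule.Quotient.mk γ)) ψ : Hilb E d) =
      stringZ (γ : E → ZMod d) ψ)
    (hX : ∀ (γ : Z') (ψ : S), (Q.repX (.ofAdd (Submodule.Quotient.mk γ)) ψ : Hilb E d) =
      stringX (γ : E → ZMod d) ψ) {Ψ : Hilb E d} (hΨ : Ψ ∈ S) (hne : Ψ ≠ 0) :
    Submodule.span ℂ {φ : Hilb E d | ∃ τ' ∈ Z', ∃ τ ∈ Z, φ = stringX τ' (stringZ τ Ψ)} = S := by
  have hspan := congrArg (Submodule.map S.subtype)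
    (Q.span_apply_eq_top (ψ := ⟨Ψ, hΨ⟩) (Subtype.coe_ne_coe.1 hne))
  rw [Submodule.map_span, Submodule.map_top, Submodule.range_subtype] at hspan
  refine Eq.trans (congrArg _ (Set.ext fun φ => ?_)) hspan
  have happly (τ' : Z') (τ : Z) : stringX (τ' : E → ZMod d) (stringZ (τ : E → ZMod d) Ψ) =
      Q.repX (.ofAdd (Submodule.Quotient.mk τ'))
        (Q.repZ (.ofAdd (Submodule.Quotient.mk τ)) ⟨Ψ, hΨ⟩) := by
    rw [hX, hZ]
  constructor
  · rintro ⟨τ', hτ', τ, hτ, rfl⟩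
    exact ⟨_, ⟨_, _, rfl⟩, (happly ⟨τ', hτ'⟩ ⟨τ, hτ⟩).symm⟩
  · rintro ⟨_, ⟨c', c, rfl⟩, rfl⟩
    obtain ⟨τ', rfl⟩ := Submodule.Quotient.mk_surjective _ c'
    obtain ⟨τ, rfl⟩ := Submodule.Quotient.mk_surjective _ c
    exact ⟨τ', τ'.2, τ, τ.2, (happly τ' τ).symm⟩

theorem PolygonDecomposition.exists_logicalQudits {E : Type*} [Fintype E] [DecidableEq E]
    [Nonempty E] (G : PolygonDecomposition E) {g : ℕ} (hg : G.HasGenus g) (d : ℕ) [NeZero d] :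
    ∃ Q : LogicalQudits (G.groundSpace d) (G.H₁ d) (G.dual.H₁ d) (Fin (2 * g)) d,
      (∀ (γ : G.cycles d) (ψ : G.groundSpace d),
        (Q.repZ (.ofAdd (G.homologyClass d γ)) ψ : Hilb E d) = stringZ (γ : E → ZMod d) ψ) ∧
      ∀ (γ : G.dual.cycles d) (ψ : G.groundSpace d),
        (Q.repX (.ofAdd (G.dual.homologyClass d γ)) ψ : Hilb E d) =
          stringX (γ : E → ZMod d) ψ := by
  obtain ⟨σ⟩ := G.nonempty_homologySplitting hg (ZMod d)
  exact σ.exists_logicalQudits G.groundSpace_eq_codeSpace G.cycles_eq_ker G.boundaries_eq_range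
    G.dual_cycles_eq_ker G.dual_boundaries_eq_range

end KitaevModel

theorem mainTheorem1 {E : Type*} [Fintype E] [DecidableEq E] [Nonempty E]
    (G : PolygonDecomposition E) (g : ℕ) (hg : G.HasGenus g) (d : ℕ) [NeZero d] :
    ∃ (π : Multiplicative (G.H₁ d) →* (G.groundSpace d ≃ₗᵢ[ℂ] G.groundSpace d))
      (π' : Multiplicative (G.dual.H₁ d) →* (G.groundSpace d ≃ₗᵢ[ℂ] G.groundSpace d)),
      -- (i) the representations of homology and of cohomology (the homology of the dual)
      (∀ (γ : G.cycles d) (ψ : G.groundSpace d),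
        (π (.ofAdd (G.homologyClass d γ)) ψ : Hilb E d) = stringZ (γ : E → ZMod d) ψ) ∧
      (∀ (γ : G.dual.cycles d) (ψ : G.groundSpace d),
        (π' (.ofAdd (G.dual.homologyClass d γ)) ψ : Hilb E d) = stringX (γ : E → ZMod d) ψ) ∧
      -- (ii) labellings of the (co)homology classes, generators and relations
      Nonempty (Label g d ≃+ G.H₁ d) ∧
      (∀ Φ : Label g d ≃+ G.H₁ d, ∃! Φ' : Label g d ≃+ G.dual.H₁ d,
        WeylRelations (fun a => π (.ofAdd (Φ a))) (fun a => π' (.ofAdd (Φ' a)))) ∧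
      (∀ (Φ : Label g d ≃+ G.H₁ d) (Φ' : Label g d ≃+ G.dual.H₁ d),
        Algebra.adjoin ℂ (⋃ i : Fin g,
          {toEnd (π' (.ofAdd (Φ' (lab₁ i)))), toEnd (π' (.ofAdd (Φ' (lab₂ i)))),
            toEnd (π (.ofAdd (Φ (lab₁ i)))), toEnd (π (.ofAdd (Φ (lab₂ i))))} : Set (Module.End ℂ (G.groundSpace d))) =
          algebraOn (G.groundSpace d) ∧
        ∀ a : Label g d, π' (.ofAdd (Φ' a)) ^ d = 1 ∧ π (.ofAdd (Φ a)) ^ d = 1) ∧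
      Nonempty (algebraOn (G.groundSpace d) ≃ₐ[ℂ]
        ⨂[ℂ] _ : Fin (2 * g), Matrix (Fin d) (Fin d) ℂ) ∧
      -- (iii) the degeneracy
      Module.finrank ℂ (G.groundSpace d) = d ^ G.betti₁ d ∧
      Module.finrank ℂ (G.groundSpace d) = d ^ (2 * g) ∧
      -- (iv) cyclicity
      ∀ Ψ ∈ G.groundSpace d, Ψ ≠ 0 →
        Submodule.span ℂ {φ : Hilb E d | ∃ τ' ∈ G.dual.cycles d, ∃ τ ∈ G.cycles d,
          φ = stringX τ' (stringZ τ Ψ)} = G.groundSpace d := by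
  obtain ⟨Q, hZ, hX⟩ := G.exists_logicalQudits hg d
  obtain ⟨tensor⟩ := Q.nonempty_algEquiv
  refine ⟨Q.repZ, Q.repX, hZ, hX, ⟨(labelEquiv g d ≪≫ₗ Q.coordZ.symm).toAddEquiv⟩,
    Q.existsUnique_weylRelations, fun Φ Φ' => ⟨?_, fun a => ?_⟩, ⟨?_⟩, Q.finrank_eq_pow_rank, ?_,
    fun Ψ => Q.span_stringX_stringZ_eq hZ hX⟩
  · exact (Q.adjoin_eq_top Φ Φ').trans (algebraOn_eq_top _).symm
  · exact ⟨map_ofAdd_pow_card _ _, map_ofAdd_pow_card _ _⟩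
  · exact (Subalgebra.equivOfEq _ _ (algebraOn_eq_top _)).trans (Subalgebra.topEquiv.trans tensor)
  · rw [Q.finrank_eq, Fintype.card_fin]
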